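/- Let $V$ be a $d$-dimensional vector space, $d\ge 2$, over a finite field $\mathbb F$ with $\operatorname{char}\mathbb F>d$, equipped with a non-degenerate symmetric bilinear form $\langle\cdot,\cdot\rangle$. Let $\Phi=(\phi_1,\dots,\phi_n)$ be an $(a,b)$-equiangular system in $V$, i.e. $\langle\phi_j,\phi_j\rangle=a$ for all $j$ and $\langle\phi_j,\phi_k\rangle^2=b$ for $j\ne k$, with $a\ne0$, $b\neq 0$ and $a^2\ne b$; fix $\beta\in\mathbb F$ with $\beta^2=b$ and put $\rho=a\beta^{-1}$. Call a triple of distinct vectors of $\Phi$ coherent if $\langle\phi_i,\phi_j\rangle\langle\phi_j,\phi_k\rangle\langle\phi_k,\phi_i\rangle=-\beta^3$. Assume that the two-graph on $\Phi$ formed by the coherent triples is regular with parameters $(n,\ell,m)$: every pair of vectors lies in exactly $\ell$ coherent triples, and every coherent triple lies in exactly $m$ quadruples all of whose triples are coherent. A subset of $\Phi$ is $\beta$-incoherent if it has at most two elements or all its triples of distinct vectors have triple product $\beta^3$. Let $\Gamma\subseteq\Phi$ be a $\beta$-incoherent set, maximal under inclusion, which has $d$ elements and is linearly independent. For $\gamma\in\Phi\setminus\Gamma$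 choose $\alpha_1,\alpha_2\in\Gamma$ such that $\{\gamma,\alpha_1,\alpha_2\}$ is coherent (these exist) and put $\Gamma_i(\gamma)=\{\delta\in\Gamma:\{\gamma,\alpha_i,\delta\}\text{ is coherent}\}$, labelled such that $|\Gamma_1(\gamma)|\le|\Gamma_2(\gamma)|$. Then there are integers $0\le g_1\le g_2$ with $g_1+g_2=d$ such that $|\Gamma_i(\gamma)|=g_i$ for all $\gamma\in\Phi\setminus\Gamma$ and $i=1,2$, and, with $\mathcal B_i=\{\Gamma_i(\gamma):\gamma\in\Phi\setminus\Gamma\}$, the following hold. (A $t$-$(v,k,\lambda)$ design is a $v$-set of points with a set of $k$-element blocks such that any $t$ points lie in exactly $\lambda$ blocks.) 1. Suppose $g_1\ne g_2$. Then: - for $\{i,j\}=\{1,2\}$, $(\Gamma,\mathcal B_i)$ is a $2$-$(d,g_i,\lambda_i)$ design with $\lambda_i=\dfrac{\ell(g_i-1)}{2g_j}$ (in particular an integer; if $\Phi=\Gamma$ then $\mathcal B_i$ is empty and $\ell=\lambda_i=0$); - if $n>2d$, then there are least non-negative integers $s_1,s_2$ whose images in $\mathbb F$ satisfy $s_1\equiv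 g_1-(\rho-1)^2/4$ and $s_2\equiv g_1-(\rho^2-1)/4$, and $(\Gamma,\mathcal B_1)$ is quasi-symmetric: the sizes of the intersections of two distinct blocks are exactly $s_1$ and $s_2$ (in some order of magnitude); - if $n=d(d+1)/2$, then $(\Gamma,\mathcal B_1)$ is a $4$-design, i.e. a $4$-$(d,g_1,\lambda)$ design for some $\lambda$; - if $n=2d$, then $(\Gamma,\mathcal B_1)$ is a symmetric $2$-$(d,g_1,\lambda_1;s)$ design: $|\mathcal B_1|=d$ and any two distinct blocks meet in exactly $s$ points, where $s$ is the least non-negative integer satisfying one of the two congruences above. 2. If $g_1=g_2$, then $(\Gamma,\mathcal B_1\cup\mathcal B_2)$ is a $2$-$(d,d/2,n-d-\ell)$ design. -/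

import Mathlib

namespace EquiangularDesign

/-- `(Ω, 𝓑)` is a `t`-`(v, k, lam)` design: `Ω` has `v` points, the blocks are `k`-element
subsets of `Ω`, and any `t` points lie together in exactly `lam` blocks. -/
structure IsDesign {P : Type*} [DecidableEq P] (t v k lam : ℕ)
    (Ω : Finset P) (𝓑 : Finset (Finset P)) : Prop where
  card_points : Ω.card = v
  block_subset : ∀ A ∈ 𝓑, A ⊆ Ω
  card_block : ∀ A ∈ 𝓑, A.card = k
  card_containing : ∀ T ⊆ Ω, T.card = t → (𝓑.filter (fun A => T ⊆ A)).card = lam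

/-- A quasi-symmetric `2`-`(v, k, lam; s₁, s₂)` design: a `2`-design whose block intersection
numbers (sizes of intersections of two distinct blocks) are exactly `s₁ ≤ s₂`. -/
structure IsQuasiSymmetricDesign {P : Type*} [DecidableEq P] (v k lam s₁ s₂ : ℕ)
    (Ω : Finset P) (𝓑 : Finset (Finset P)) : Prop where
  isDesign : IsDesign 2 v k lam Ω 𝓑
  le : s₁ ≤ s₂
  card_inter : ∀ A ∈ 𝓑, ∀ A' ∈ 𝓑, A ≠ A' → (A ∩ A').card = s₁ ∨ (A ∩ A').card = s₂
  exists_inter_fst : ∃ A ∈ 𝓑, ∃ A' ∈ 𝓑, A ≠ A' ∧ (A ∩ A').card = s₁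
  exists_inter_snd : ∃ A ∈ 𝓑, ∃ A' ∈ 𝓑, A ≠ A' ∧ (A ∩ A').card = s₂

/-- A symmetric `2`-`(v, k, lam; s)` design: a `2`-design with as many blocks as points, any two
distinct blocks of which meet in exactly `s` points. -/
structure IsSymmetricDesign {P : Type*} [DecidableEq P] (v k lam s : ℕ)
    (Ω : Finset P) (𝓑 : Finset (Finset P)) : Prop where
  isDesign : IsDesign 2 v k lam Ω 𝓑
  card_blocks : 𝓑.card = v
  card_inter : ∀ A ∈ 𝓑, ∀ A' ∈ 𝓑, A ≠ A' → (A ∩ A').card = s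

/-- A two-graph on a finite set `P`, given by its set `𝓒` of coherent triples: every `4`-subset
of `P` contains an even number of coherent triples. -/
structure IsTwoGraph {P : Type*} [DecidableEq P] (𝓒 : Finset (Finset P)) : Prop where
  card_triple : ∀ T ∈ 𝓒, T.card = 3
  even_card : ∀ Q : Finset P, Q.card = 4 → Even (𝓒.filter (fun T => T ⊆ Q)).card

/-- A set of points is coherent if it has at least three points and all its `3`-subsets are
coherent triples. -/
def IsCoherentSet {P : Type*} [DecidableEq P] (𝓒 : Finset (Finset P)) (Q : Finset P) : Prop :=
  3 ≤ Q.card ∧ Q.powersetCard 3 ⊆ 𝓒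

open Classical in
/-- A regular two-graph with parameters `(n, l, m)`: a two-graph on `n` points in which every pair
of points lies in `l` coherent triples and every coherent triple lies in `m` coherent quadruples.
(As soon as there is a coherent triple, counting gives `n = 3 * l - 2 * m`.) -/
structure IsRegularTwoGraph {P : Type*} [DecidableEq P] [Fintype P] (n l m : ℕ)
    (𝓒 : Finset (Finset P)) : Prop where
  isTwoGraph : IsTwoGraph 𝓒
  isDesign : IsDesign 2 n 3 l Finset.univ 𝓒
  card_quadruples : ∀ T ∈ 𝓒,
    ((Finset.univ : Finset (Finset P)).filter
      (fun Q => Q.card = 4 ∧ T ⊆ Q ∧ IsCoherentSet 𝓒 Q)).card = m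

variable {F V : Type*} [Field F] [AddCommGroup V] [Module F V] {n : ℕ}

/-- `(a, b)`-equiangular systems, for a symmetric scalar product `B`. -/
structure IsEquiangular (B : LinearMap.BilinForm F V) (a b : F) (Φ : Fin n → V) : Prop where
  norm_eq : ∀ j, B (Φ j) (Φ j) = a
  double_product : ∀ j k, j ≠ k → B (Φ j) (Φ k) * B (Φ k) (Φ j) = b

/-- The triple product `Δ(x, y, z) = ⟨x, y⟩⟨y, z⟩⟨z, x⟩`. -/
def tripleProduct (B : LinearMap.BilinForm F V) (x y z : V) : F :=
  B x y * B y z * B z x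

open Classical in
/-- The coherent triples of the two-graph induced by `Φ` with respect to `β`: the triples of
(indices of) distinct vectors with triple product `-β ^ 3`. -/
noncomputable def coherentTriples (B : LinearMap.BilinForm F V) (β : F) (Φ : Fin n → V) :
    Finset (Finset (Fin n)) :=
  (Finset.univ.powersetCard 3).filter
    (fun T => ∃ i j k, T = {i, j, k} ∧ tripleProduct B (Φ i) (Φ j) (Φ k) = -β ^ 3)

/-- `β`-incoherent subsets of `Φ`, as sets of indices. -/
def IsIncoherent (B : LinearMap.BilinForm F V) (β : F) (Φ : Fin n → V)
    (Γ : Finset (Fin n)) : Prop :=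
  Γ.card ≤ 2 ∨ ∀ i ∈ Γ, ∀ j ∈ Γ, ∀ k ∈ Γ, i ≠ j → j ≠ k → i ≠ k →
    tripleProduct B (Φ i) (Φ j) (Φ k) = β ^ 3

/-- The set of all `δ ∈ Γ` such that `{γ, α, δ}` is a coherent triple. -/
noncomputable def cell (B : LinearMap.BilinForm F V) (β : F) (Φ : Fin n → V)
    (Γ : Finset (Fin n)) (γ α : Fin n) : Finset (Fin n) :=
  Γ.filter (fun δ => ({γ, α, δ} : Finset (Fin n)) ∈ coherentTriples B β Φ)

/-- `A₁, A₂` are the two sets `Γ₁(γ), Γ₂(γ)`: for some `α₁, α₂ ∈ Γ` forming a coherent triple with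
`γ`, the set `Aᵢ` consists of the `δ ∈ Γ` with `{γ, αᵢ, δ}` coherent, and the labels are chosen
such that `|A₁| ≤ |A₂|`. (If the sizes agree, both labellings are allowed.) -/
def IsSplitting (B : LinearMap.BilinForm F V) (β : F) (Φ : Fin n → V)
    (Γ : Finset (Fin n)) (γ : Fin n) (A₁ A₂ : Finset (Fin n)) : Prop :=
  ∃ α₁ ∈ Γ, ∃ α₂ ∈ Γ, ({γ, α₁, α₂} : Finset (Fin n)) ∈ coherentTriples B β Φ ∧
    A₁ = cell B β Φ Γ γ α₁ ∧ A₂ = cell B β Φ Γ γ α₂ ∧ A₁.card ≤ A₂.card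

open Classical in
/-- `𝓑₁`, the set of all `Γ₁(γ)` with `γ ∉ Γ`. -/
noncomputable def blocks₁ (B : LinearMap.BilinForm F V) (β : F) (Φ : Fin n → V)
    (Γ : Finset (Fin n)) : Finset (Finset (Fin n)) :=
  Finset.univ.filter (fun A₁ => ∃ γ, γ ∉ Γ ∧ ∃ A₂, IsSplitting B β Φ Γ γ A₁ A₂)

open Classical in
/-- `𝓑₂`, the set of all `Γ₂(γ)` with `γ ∉ Γ`. -/
noncomputable def blocks₂ (B : LinearMap.BilinForm F V) (β : F) (Φ : Fin n → V)
    (Γ : Finset (Fin n)) : Finset (Finset (Fin n)) :=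
  Finset.univ.filter (fun A₂ => ∃ γ, γ ∉ Γ ∧ ∃ A₁, IsSplitting B β Φ Γ γ A₁ A₂)

end EquiangularDesign

open EquiangularDesign

/-! ### Double counting, square designs and Fisher's inequality -/

section Counting

open Finset

variable {κ P : Type*} [DecidableEq P] {C : Finset κ} {A : κ → Finset P} {Γ : Finset P}
  {d k l : ℕ}

/-! The set `Γ` consists of `d` independent vectors, hence is a basis, and incoherence allows sign
changes after which its Gram matrix is `(a - β)I + βJ`. A vector `γ` outside `Γ` has products `±β`
with the switched basis, so it is encoded by a cut of `Γ` into two parts; `A γ` denotes one of size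
at most `d/2`. The triple `{γ, α, δ}` is coherent exactly when the cut separates `α` from `δ`, so
the two parts are `Γ₁(γ)` and `Γ₂(γ)`; maximality of `Γ` makes both nonempty.

Inverting the Gram matrix expresses `⟨γ, γ'⟩`, up to sign, through the sizes of `A γ`, `A γ'` and `A
γ ∩ A γ'` (`exists_parts`). For `γ = γ'` this is a quadratic equation for the part size, symmetric
under `k ↦ d - k`; since the characteristic exceeds `d`, the smaller size `k` is the same for all
`γ`. For `γ ≠ γ'` the product is `±β`, which leaves two possible values in `F` for the intersection
size, neither equal to `k`; in particular `γ ↦ A γ` is injective.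

Regularity of the two-graph says that each pair of `Γ` is separated by exactly `l` outside vectors
(`card_separating`). If `d ≠ 2k`, double counting turns this into constant replication and pair
counts, that is, into 2-designs. If `d = 2k`, a pair is covered by a part of `γ` exactly when `γ`
does not separate it, which gives `n - d - l` blocks through each pair.

The remaining claims depend on the number `n - d` of blocks. More than `d` blocks: by Fisher's
inequality one intersection number is not enough. Exactly `d` blocks: a variance argument makes the
intersections constant. Exactly `d.choose 2` blocks: the pair-block incidence matrix `W` is square,
the two intersection numbers give an explicit inverse, and the resulting equation forces `W Wᵀ` to
be invariant under all permutations of the points, which is the 4-design property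
(`card_filter_subset_eq_of_tight`). -/

theorem sum_ite_mem_eq_card {S Γ : Finset P} (h : S ⊆ Γ) :
    ∑ α ∈ Γ, (if α ∈ S then (1 : ℤ) else 0) = S.card := by
  rw [← Finset.sum_filter, Finset.filter_mem_eq_inter, Finset.inter_eq_right.2 h]
  simp

theorem sum_card_filter_mem (hsub : ∀ γ ∈ C, A γ ⊆ Γ) (hk : ∀ γ ∈ C, (A γ).card = k) :
    ∑ α ∈ Γ, ((C.filter (fun γ => α ∈ A γ)).card : ℤ) = C.card * k := by
  have : ∀ α ∈ Γ, ((C.filter (fun γ => α ∈ A γ)).card : ℤ)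
      = ∑ γ ∈ C, if α ∈ A γ then (1 : ℤ) else 0 := by
    intro α _; simp
  rw [Finset.sum_congr rfl this, Finset.sum_comm,
    Finset.sum_congr rfl (fun γ hγ => (sum_ite_mem_eq_card (hsub γ hγ)).trans (by rw [hk γ hγ]))]
  simp

theorem sum_card_filter_mem_and (hsub : ∀ γ ∈ C, A γ ⊆ Γ) (hk : ∀ γ ∈ C, (A γ).card = k) (α : P) :
    ∑ δ ∈ Γ, ((C.filter (fun γ => α ∈ A γ ∧ δ ∈ A γ)).card : ℤ)
      = (C.filter (fun γ => α ∈ A γ)).card * k := by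
  simp_rw [← Finset.filter_filter]
  exact sum_card_filter_mem (fun γ hγ => hsub γ (Finset.mem_filter.1 hγ).1)
    (fun γ hγ => hk γ (Finset.mem_filter.1 hγ).1)

/-- Each block contributes to both sides the number of elements of `{α, δ}`, with multiplicity, that
it contains. -/
theorem card_separating_add (α δ : P) :
    (C.filter (fun γ => α ∈ A γ ↔ δ ∉ A γ)).card
      + 2 * (C.filter (fun γ => α ∈ A γ ∧ δ ∈ A γ)).card
      = (C.filter (fun γ => α ∈ A γ)).card + (C.filter (fun γ => δ ∈ A γ)).card := by
  simp only [Finset.card_filter, Finset.mul_sum, ← Finset.sum_add_distrib]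
  refine Finset.sum_congr rfl fun γ _ => ?_
  by_cases h1 : α ∈ A γ <;> by_cases h2 : δ ∈ A γ <;> simp [h1, h2]

/-- Sum `card_separating_add` over all `δ ∈ Γ`; the term `δ = α` has no separating block, hence the
factor `d - 1`. -/
theorem card_filter_mem_mul_sub (hsub : ∀ γ ∈ C, A γ ⊆ Γ) (hk : ∀ γ ∈ C, (A γ).card = k)
    (hd : Γ.card = d)
    (hl : ∀ α ∈ Γ, ∀ δ ∈ Γ, α ≠ δ → (C.filter (fun γ => α ∈ A γ ↔ δ ∉ A γ)).card = l)
    {α : P} (hα : α ∈ Γ) :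
    ((C.filter (fun γ => α ∈ A γ)).card : ℤ) * (d - 2 * k) = (d - 1) * l - C.card * k := by
  have h1 := sum_card_filter_mem hsub hk
  have h2 := sum_card_filter_mem_and hsub hk α
  have h3 : ∑ δ ∈ Γ, ((C.filter (fun γ => α ∈ A γ ↔ δ ∉ A γ)).card : ℤ) = (d - 1) * l := by
    rw [← Finset.add_sum_erase _ _ hα, Finset.sum_congr rfl (fun δ hδ => by
      rw [hl α hα δ (Finset.mem_of_mem_erase hδ) (Finset.ne_of_mem_erase hδ).symm])]
    have : (((Γ.erase α).card : ℕ) : ℤ) = d - 1 := by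
      have := Finset.card_erase_add_one hα
      omega
    simp [this]
  have h4 := Finset.sum_congr (s₁ := Γ) rfl (fun δ _ => congrArg (Nat.cast (R := ℤ))
    (card_separating_add (C := C) (A := A) α δ))
  push_cast at h4
  rw [Finset.sum_add_distrib, Finset.sum_add_distrib, ← Finset.mul_sum, h1, h2, h3] at h4
  simp only [Finset.sum_const, hd, nsmul_eq_mul] at h4
  linarith

/-- Summing the previous identity over `α` gives a second relation between `C.card` and `l`, and
`C.card` is eliminated. Cancelling `d - 2k` is what requires blocks not of half size. -/
theorem two_mul_card_filter_mem (hsub : ∀ γ ∈ C, A γ ⊆ Γ) (hk : ∀ γ ∈ C, (A γ).card = k)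
    (hd : Γ.card = d) (hne : d ≠ 2 * k)
    (hl : ∀ α ∈ Γ, ∀ δ ∈ Γ, α ≠ δ → (C.filter (fun γ => α ∈ A γ ↔ δ ∉ A γ)).card = l)
    {α : P} (hα : α ∈ Γ) :
    2 * ((d : ℤ) - k) * (C.filter (fun γ => α ∈ A γ)).card = (d - 1) * l := by
  have h1 := sum_card_filter_mem hsub hk
  have h2 := fun α hα => card_filter_mem_mul_sub hsub hk hd hl (α := α) hα
  have h3 := Finset.sum_congr (s₁ := Γ) rfl h2
  rw [← Finset.sum_mul, h1] at h3
  simp only [Finset.sum_const, hd, nsmul_eq_mul] at h3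
  have hne' : (d : ℤ) - 2 * k ≠ 0 := by omega
  apply mul_right_cancel₀ hne'
  linear_combination (2 * ((d : ℤ) - k)) * h2 α hα - h3

theorem two_mul_card_filter_mem_and (hsub : ∀ γ ∈ C, A γ ⊆ Γ) (hk : ∀ γ ∈ C, (A γ).card = k)
    (hd : Γ.card = d) (hne : d ≠ 2 * k)
    (hl : ∀ α ∈ Γ, ∀ δ ∈ Γ, α ≠ δ → (C.filter (fun γ => α ∈ A γ ↔ δ ∉ A γ)).card = l)
    {α δ : P} (hα : α ∈ Γ) (hδ : δ ∈ Γ) (h : α ≠ δ) :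
    2 * ((d : ℤ) - k) * (C.filter (fun γ => α ∈ A γ ∧ δ ∈ A γ)).card = l * (k - 1) := by
  have h1 := two_mul_card_filter_mem hsub hk hd hne hl hα
  have h2 := two_mul_card_filter_mem hsub hk hd hne hl hδ
  have h3 := card_separating_add (C := C) (A := A) α δ
  rw [hl α hα δ hδ h] at h3
  have h3' := congrArg (Nat.cast (R := ℤ)) h3
  push_cast at h3'
  have h4 : (2 : ℤ) ≠ 0 := two_ne_zero
  apply mul_left_cancel₀ h4
  linear_combination h1 + h2 + (2 * ((d : ℤ) - k)) * h3'

/-- A square `2`-design is symmetric. -/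
theorem card_inter_eq_of_card_eq [DecidableEq κ] (hsub : ∀ γ ∈ C, A γ ⊆ Γ)
    (hk : ∀ γ ∈ C, (A γ).card = k) (hC : C.card = d) {lam : ℕ}
    (hr : ∀ α ∈ Γ, (C.filter (fun γ => α ∈ A γ)).card = k)
    (hlam : ∀ α ∈ Γ, ∀ δ ∈ Γ, α ≠ δ → (C.filter (fun γ => α ∈ A γ ∧ δ ∈ A γ)).card = lam)
    (hkl : (lam : ℤ) * (d - 1) = k * (k - 1))
    {γ₀ γ₁ : κ} (h₀ : γ₀ ∈ C) (h₁ : γ₁ ∈ C) (h : γ₁ ≠ γ₀) :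
    (A γ₁ ∩ A γ₀).card = lam := by
  have e1 : ∑ γ ∈ C, ((A γ ∩ A γ₀).card : ℤ) = k * k := by
    have := sum_card_filter_mem (C := A γ₀) (Γ := C)
      (A := fun α => C.filter (fun γ => α ∈ A γ)) (k := k) (fun α _ => Finset.filter_subset _ _)
      (fun α hα => hr α (hsub _ h₀ hα))
    rw [hk _ h₀] at this
    rw [← this]
    refine Finset.sum_congr rfl fun γ hγ => ?_
    congr 2
    ext α
    simp [hγ, and_comm]
  have e2 : ∑ γ ∈ C, ((A γ ∩ A γ₀).card : ℤ) ^ 2 = k * k + k * (k - 1) * lam := by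
    have s1 : ∀ γ ∈ C, ((A γ ∩ A γ₀).card : ℤ) ^ 2 = ∑ α ∈ A γ₀, ∑ δ ∈ A γ₀,
        if α ∈ A γ ∧ δ ∈ A γ then (1 : ℤ) else 0 := by
      intro γ _
      have : ((A γ ∩ A γ₀).card : ℤ) = ∑ α ∈ A γ₀, if α ∈ A γ then (1 : ℤ) else 0 := by
        rw [← Finset.sum_filter, Finset.filter_mem_eq_inter, Finset.inter_comm]
        simp
      rw [this, sq, Finset.sum_mul_sum]
      refine Finset.sum_congr rfl fun α _ => Finset.sum_congr rfl fun δ _ => ?_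
      by_cases h1 : α ∈ A γ <;> by_cases h2 : δ ∈ A γ <;> simp [h1, h2]
    rw [Finset.sum_congr rfl s1, Finset.sum_comm]
    have s2 : ∀ α ∈ A γ₀, (∑ γ ∈ C, ∑ δ ∈ A γ₀, if α ∈ A γ ∧ δ ∈ A γ then (1 : ℤ) else 0)
        = k + (k - 1) * lam := by
      intro α hα
      rw [Finset.sum_comm, ← Finset.add_sum_erase _ _ hα]
      have t1 : (∑ γ ∈ C, if α ∈ A γ ∧ α ∈ A γ then (1 : ℤ) else 0) = k := by
        simp [hr α (hsub _ h₀ hα)]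
      have t2 : ∀ δ ∈ (A γ₀).erase α, (∑ γ ∈ C, if α ∈ A γ ∧ δ ∈ A γ then (1 : ℤ) else 0)
          = lam := by
        intro δ hδ
        have := hlam α (hsub _ h₀ hα) δ (hsub _ h₀ (Finset.mem_of_mem_erase hδ))
          (Finset.ne_of_mem_erase hδ).symm
        rw [← this]; simp
      rw [t1, Finset.sum_congr rfl t2]
      have t3 := Finset.card_erase_add_one hα
      rw [hk _ h₀] at t3
      have t4 : (k : ℤ) = (((A γ₀).erase α).card : ℤ) + 1 := by exact_mod_cast t3.symm
      simp [t4]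
    rw [Finset.sum_congr rfl s2]
    simp [hk _ h₀]
    ring
  -- The first two moments of the intersection sizes with `A γ₀` show that the sum of squared
  -- deviations from `lam` is used up by the term `γ = γ₀`.
  have e3 : ∑ γ ∈ C.erase γ₀, (((A γ ∩ A γ₀).card : ℤ) - lam) ^ 2 = 0 := by
    have e4 : ∑ γ ∈ C, (((A γ ∩ A γ₀).card : ℤ) - lam) ^ 2
        = (k * k + k * (k - 1) * lam) - 2 * lam * (k * k) + d * lam ^ 2 := by
      have hsplit : ∑ γ ∈ C, (((A γ ∩ A γ₀).card : ℤ) - lam) ^ 2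
          = ∑ γ ∈ C, ((A γ ∩ A γ₀).card : ℤ) ^ 2 - 2 * lam * ∑ γ ∈ C, ((A γ ∩ A γ₀).card : ℤ)
            + C.card * lam ^ 2 := by
        rw [Finset.mul_sum, ← Finset.sum_sub_distrib, ← nsmul_eq_mul, ← Finset.sum_const,
          ← Finset.sum_add_distrib]
        exact Finset.sum_congr rfl fun γ _ => by ring
      rw [hsplit, e1, e2, hC]
    rw [← Finset.add_sum_erase _ _ h₀, Finset.inter_self, hk _ h₀] at e4
    linear_combination e4 + (lam : ℤ) * hkl
  have e5 := (Finset.sum_eq_zero_iff_of_nonneg (fun γ _ => sq_nonneg _)).1 e3 γ₁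
    (Finset.mem_erase.2 ⟨h, h₁⟩)
  have e6 := pow_eq_zero_iff (two_ne_zero) |>.1 e5
  omega

/-- Fisher's inequality for uniform families with constant intersections. -/
theorem card_le_of_card_inter_eq (hsub : ∀ γ ∈ C, A γ ⊆ Γ)
    (hk : ∀ γ ∈ C, (A γ).card = k) {s : ℕ} (hs : s < k)
    (hi : ∀ γ ∈ C, ∀ γ' ∈ C, γ ≠ γ' → (A γ ∩ A γ').card = s) :
    C.card ≤ Γ.card := by
  classical
  have key : LinearIndependent ℚ
      (fun γ : C => fun p : Γ => if (p : P) ∈ A γ then (1 : ℚ) else 0) := by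
    rw [Fintype.linearIndependent_iff]
    intro w hw
    have e1 : ∀ γ γ' : C, ∑ p : Γ, ((if (p : P) ∈ A γ then (1 : ℚ) else 0) *
        if (p : P) ∈ A γ' then (1 : ℚ) else 0) = s + if γ = γ' then ((k : ℚ) - s) else 0 := by
      intro γ γ'
      have : ∑ p : Γ, ((if (p : P) ∈ A γ then (1 : ℚ) else 0) *
        if (p : P) ∈ A γ' then (1 : ℚ) else 0) = ((A γ ∩ A γ').card : ℚ) := by
        rw [Finset.sum_coe_sort Γ (fun p => (if (p : P) ∈ A γ then (1 : ℚ) else 0) *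
          if (p : P) ∈ A γ' then (1 : ℚ) else 0)]
        simp only [← ite_and, mul_ite, mul_one, mul_zero]
        rw [← Finset.sum_filter]
        simp only [Finset.sum_const, nsmul_eq_mul, mul_one]
        congr 2
        ext p
        simp only [Finset.mem_filter, Finset.mem_inter]
        exact ⟨fun h => ⟨h.2.2, h.2.1⟩, fun h => ⟨hsub _ γ.2 h.1, h.2, h.1⟩⟩
      rw [this]
      by_cases h : γ = γ'
      · subst h; simp [hk _ γ.2]
      · rw [hi _ γ.2 _ γ'.2 (fun h' => h (Subtype.ext h'))]; simp [h]
    -- The Gram matrix of the indicator vectors is `sJ + (k - s)I`, which is positive definite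
    -- because `s < k`.
    have e2 : ∑ p : Γ, (∑ γ : C, w γ * if (p : P) ∈ A γ then (1 : ℚ) else 0) ^ 2
        = s * (∑ γ, w γ) ^ 2 + (k - s) * ∑ γ, w γ ^ 2 := by
      calc _ = ∑ γ : C, ∑ γ' : C, w γ * w γ' * ∑ p : Γ,
            ((if (p : P) ∈ A γ then (1 : ℚ) else 0) * if (p : P) ∈ A γ' then (1 : ℚ) else 0) := by
            simp_rw [sq, Finset.sum_mul_sum, Finset.mul_sum]
            rw [Finset.sum_comm]
            refine Finset.sum_congr rfl fun γ _ => ?_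
            rw [Finset.sum_comm]
            refine Finset.sum_congr rfl fun γ' _ => Finset.sum_congr rfl fun p _ => by ring
        _ = _ := by
            simp_rw [e1, mul_add, Finset.sum_add_distrib, ← Finset.sum_mul, mul_ite, mul_zero]
            simp only [Finset.sum_ite_eq, Finset.mem_univ, if_true]
            rw [← Finset.sum_mul, sq, Finset.sum_mul_sum]
            simp_rw [sq]
            ring
    have e3 : ∑ p : Γ, (∑ γ : C, w γ * if (p : P) ∈ A γ then (1 : ℚ) else 0) ^ 2 = 0 := by
      refine Finset.sum_eq_zero fun p _ => ?_
      have := congrFun hw p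
      simp only [Finset.sum_apply, Pi.smul_apply, smul_eq_mul, Pi.zero_apply] at this
      rw [this]; simp
    have hks : (0 : ℚ) < k - s := by
      have : (s : ℚ) < k := by exact_mod_cast hs
      linarith
    have e4 : ∑ γ, w γ ^ 2 = 0 := by
      have h1 : 0 ≤ ∑ γ, w γ ^ 2 := Finset.sum_nonneg fun γ _ => sq_nonneg _
      have h2 : 0 ≤ (s : ℚ) * (∑ γ, w γ) ^ 2 := by positivity
      have h3 : (k - s) * ∑ γ, w γ ^ 2 ≤ 0 := by linarith
      have := nonpos_of_mul_nonpos_right h3 hks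
      linarith
    intro γ
    have := (Finset.sum_eq_zero_iff_of_nonneg (fun γ _ => sq_nonneg (w γ))).1 e4 γ
      (Finset.mem_univ _)
    exact pow_eq_zero_iff two_ne_zero |>.1 this
  have := key.fintype_card_le_finrank
  simpa using this

end Counting

/-! ### Tight quasi-symmetric designs are 4-designs -/

section Tight

open Finset

variable {J P : Type*} [DecidableEq P]

/-- The incidence matrix of the `2`-subsets of `P` against a family of blocks. -/
def pairIncidence (A : J → Finset P) : Matrix {p : Finset P // p.card = 2} J ℚ :=
  Matrix.of fun p j => if (p : Finset P) ⊆ A j then 1 else 0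

variable (P) in
/-- The incidence matrix of the points against the `2`-subsets of `P`. -/
def pointPairIncidence : Matrix P {p : Finset P // p.card = 2} ℚ :=
  Matrix.of fun x p => if x ∈ (p : Finset P) then 1 else 0

/-- The all-ones matrix. -/
def onesMatrix (I J : Type*) : Matrix I J ℚ := Matrix.of fun _ _ => 1

open Matrix

theorem pairIncidence_mul_onesMatrix [Fintype J] {I : Type*} {A : J → Finset P} {lam : ℕ}
    (hlam : ∀ p : Finset P, p.card = 2 → (univ.filter (fun j => p ⊆ A j)).card = lam) :
    pairIncidence A * onesMatrix J I = (lam : ℚ) • onesMatrix _ I := by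
  ext p i
  simp [Matrix.mul_apply, onesMatrix, pairIncidence, ← hlam p p.2]

theorem pairIncidence_mul_transpose [Fintype J] (A : J → Finset P)
    (p q : {p : Finset P // p.card = 2}) :
    (pairIncidence A * (pairIncidence A)ᵀ) p q
      = (univ.filter (fun j => (p : Finset P) ∪ q ⊆ A j)).card := by
  simp only [Matrix.mul_apply, pairIncidence, Matrix.transpose_apply, Matrix.of_apply,
    Finset.union_subset_iff, Finset.cast_card, Finset.sum_filter]
  refine Finset.sum_congr rfl fun j _ => ?_
  split_ifs <;> simp_all

variable [Fintype P]

theorem sum_pairs_subset (S : Finset P) :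
    ∑ p : {p : Finset P // p.card = 2}, (if (p : Finset P) ⊆ S then (1 : ℚ) else 0)
      = (S.card.choose 2 : ℕ) := by
  rw [← Finset.card_powersetCard, ← Finset.sum_filter, Finset.sum_const, nsmul_eq_mul, mul_one]
  norm_cast
  refine Finset.card_bij (fun p _ => p.1) ?_ ?_ ?_
  · intro p hp
    exact Finset.mem_powersetCard.2 ⟨(Finset.mem_filter.1 hp).2, p.2⟩
  · intro p _ q _ h
    exact Subtype.ext h
  · intro p hp
    obtain ⟨h1, h2⟩ := Finset.mem_powersetCard.1 hp
    exact ⟨⟨p, h2⟩, by simpa using h1, rfl⟩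

theorem sum_pairs_subset_mem (S : Finset P) (x : P) :
    ∑ p : {p : Finset P // p.card = 2}, (if x ∈ (p : Finset P) then (1 : ℚ) else 0) *
      (if (p : Finset P) ⊆ S then (1 : ℚ) else 0)
      = ((S.card : ℚ) - 1) * if x ∈ S then 1 else 0 := by
  simp only [← ite_and, mul_ite, mul_one, mul_zero]
  rw [← Finset.sum_filter, Finset.sum_const, nsmul_eq_mul, mul_one]
  by_cases hx : x ∈ S
  · have h1 : (S.erase x).card + 1 = S.card := Finset.card_erase_add_one hx
    rw [if_pos hx, ← h1]
    push_cast
    rw [add_sub_cancel_right]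
    norm_cast
    symm
    refine Finset.card_bij (fun y hy => ⟨{x, y}, Finset.card_pair
      (Finset.ne_of_mem_erase hy).symm⟩) ?_ ?_ ?_
    · intro y hy
      have := Finset.mem_of_mem_erase hy
      simp [Finset.insert_subset_iff, hx, this]
    · intro y hy z hz h
      have h' : ({x, y} : Finset P) = {x, z} := congrArg Subtype.val h
      have : y ∈ ({x, z} : Finset P) := h' ▸ by simp
      simpa [Finset.ne_of_mem_erase hy] using this
    · rintro ⟨p, hp⟩ h
      simp only [Finset.mem_filter, Finset.mem_univ, true_and] at h
      obtain ⟨u, v, huv, rfl⟩ := Finset.card_eq_two.1 hp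
      simp only [Finset.insert_subset_iff, Finset.singleton_subset_iff, Finset.mem_insert,
        Finset.mem_singleton] at h
      obtain ⟨⟨hu, hv⟩, rfl | rfl⟩ := h
      · exact ⟨v, Finset.mem_erase.2 ⟨huv.symm, hv⟩, rfl⟩
      · exact ⟨u, Finset.mem_erase.2 ⟨huv, hu⟩, Subtype.ext (Finset.pair_comm _ _)⟩
  · rw [if_neg hx, Finset.card_eq_zero.2]
    · simp
    · ext p
      simp only [Finset.mem_filter, Finset.mem_univ, true_and, Finset.notMem_empty, iff_false]
      exact fun h => hx (h.1 h.2)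

theorem pairIncidence_transpose_mul_self (A : J → Finset P) (i j : J) :
    ((pairIncidence A)ᵀ * pairIncidence A) i j = ((A i ∩ A j).card.choose 2 : ℕ) := by
  rw [← sum_pairs_subset, Matrix.mul_apply]
  refine Finset.sum_congr rfl fun p _ => ?_
  simp only [pairIncidence, Matrix.transpose_apply, Matrix.of_apply, Finset.subset_inter_iff,
    ite_and, mul_ite, mul_one, mul_zero]
  split_ifs <;> rfl

/-- A point of a block lies in `k - 1` pairs inside that block. Thus the point-block incidence is a
multiple of `N W`, and intersection sizes themselves become accessible from `W`. -/
theorem pointPairIncidence_mul_pairIncidence {A : J → Finset P} {k : ℕ}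
    (hk : ∀ j, (A j).card = k) (x : P) (j : J) :
    (pointPairIncidence P * pairIncidence A) x j
      = ((k : ℚ) - 1) * if x ∈ A j then 1 else 0 := by
  rw [← hk j, ← sum_pairs_subset_mem, Matrix.mul_apply]
  rfl

theorem transpose_pointPairIncidence_mul {A : J → Finset P} {k : ℕ}
    (hk : ∀ j, (A j).card = k) (i j : J) :
    ((pointPairIncidence P * pairIncidence A)ᵀ * (pointPairIncidence P * pairIncidence A)) i j
      = ((k : ℚ) - 1) ^ 2 * (A i ∩ A j).card := by
  rw [Matrix.mul_apply]
  simp only [Matrix.transpose_apply, pointPairIncidence_mul_pairIncidence hk]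
  rw [Finset.cast_card, ← Finset.filter_mem_eq_inter, Finset.sum_filter]
  rw [Finset.mul_sum, ← Finset.sum_subset (Finset.subset_univ (A i))]
  · refine Finset.sum_congr rfl fun x hx => ?_
    simp only [hx, if_true]
    split_ifs <;> ring
  · intro x _ hx
    simp [hx]

theorem onesMatrix_mul_pairIncidence {I : Type*} {A : J → Finset P} {k : ℕ}
    (hk : ∀ j, (A j).card = k) :
    onesMatrix I {p : Finset P // p.card = 2} * pairIncidence A = ((k.choose 2 : ℕ) : ℚ) • onesMatrix I J := by
  ext i j
  have := sum_pairs_subset (A j)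
  rw [hk j] at this
  rw [Matrix.mul_apply, Matrix.smul_apply]
  simpa only [onesMatrix, pairIncidence, Matrix.of_apply, one_mul, smul_eq_mul, mul_one] using this

/-- In a quasi-symmetric design with as many blocks as pairs of points, the Gram matrix of the
pair incidence matrix satisfies a linear equation determined by the parameters. -/
theorem exists_gram_equation [Fintype J] [DecidableEq J] {A : J → Finset P} {k s₁ s₂ lam : ℕ}
    (hJ : Fintype.card J = (Fintype.card P).choose 2)
    (hk : ∀ j, (A j).card = k) (hk2 : 2 ≤ k) (h₁ : s₁ < k) (h₂ : s₂ < k)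
    (hi : ∀ i j, i ≠ j → (A i ∩ A j).card = s₁ ∨ (A i ∩ A j).card = s₂)
    (hlam : ∀ p : Finset P, p.card = 2 → (univ.filter (fun j => p ⊆ A j)).card = lam) :
    ∃ q e c : ℚ, q ≠ 0 ∧
      (pairIncidence A * (pairIncidence A)ᵀ) *
        ((2 : ℚ) • 1 - e • ((pointPairIncidence P)ᵀ * pointPairIncidence P))
      = q • 1 - c • onesMatrix _ _ := by
  have hk' : ((k : ℚ) - 1) ≠ 0 := by
    have : (2 : ℚ) ≤ k := by exact_mod_cast hk2
    intro h; linarith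
  have hch : ((k.choose 2 : ℕ) : ℚ) ≠ 0 := by
    exact_mod_cast (Nat.choose_pos hk2).ne'
  obtain ⟨q, hqdef⟩ : ∃ q : ℚ, q = ((k : ℚ) - s₁) * (k - s₂) := ⟨_, rfl⟩
  have hq : q ≠ 0 := by
    rw [hqdef]
    exact mul_ne_zero (sub_ne_zero.2 (by exact_mod_cast h₁.ne'))
      (sub_ne_zero.2 (by exact_mod_cast h₂.ne'))
  obtain ⟨e, he⟩ : ∃ e : ℚ, e = ((s₁ : ℚ) + s₂ - 1) / (k - 1) ^ 2 := ⟨_, rfl⟩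
  obtain ⟨c, hc⟩ : ∃ c : ℚ, c = (s₁ : ℚ) * s₂ / (k.choose 2 : ℕ) := ⟨_, rfl⟩
  set W := pairIncidence A with hW
  set N := pointPairIncidence P with hN
  -- With `t` the size of an intersection, the entries before scaling are `2 * t.choose 2 - (s₁ + s₂
  -- - 1) t + s₁ s₂ = (t - s₁)(t - s₂)`. This vanishes off the diagonal and equals `q` for `t = k`,
  -- which explains `q`, `e` and `c`.
  have key : (q⁻¹ • ((2 : ℚ) • Wᵀ - e • (Wᵀ * (Nᵀ * N)) + c • onesMatrix _ _)) * W = 1 := by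
    have h3 : Wᵀ * (Nᵀ * N) * W = (N * W)ᵀ * (N * W) := by
      rw [Matrix.transpose_mul]; simp only [Matrix.mul_assoc]
    rw [Matrix.smul_mul, Matrix.add_mul, Matrix.sub_mul, Matrix.smul_mul, Matrix.smul_mul,
      Matrix.smul_mul, h3, onesMatrix_mul_pairIncidence hk]
    ext i j
    simp only [Matrix.smul_apply, Matrix.add_apply, Matrix.sub_apply, smul_eq_mul, hW, hN,
      pairIncidence_transpose_mul_self, transpose_pointPairIncidence_mul hk]
    rw [Nat.cast_choose_two, he, hc]
    have h4 : (onesMatrix J J i j) = 1 := rfl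
    rw [h4, Matrix.one_apply]
    split_ifs with hij
    · subst hij
      rw [Finset.inter_self, hk i]
      field_simp
      rw [hqdef]; ring
    · rcases hi i j hij with h | h <;> rw [h] <;> field_simp <;> ring
  have hcard : Fintype.card {p : Finset P // p.card = 2} = Fintype.card J := by
    rw [hJ, Fintype.card_finset_len]
  -- There are as many pairs as blocks, so the left inverse of `W` is also a right inverse.
  have key2 := (Matrix.mul_eq_one_comm_of_card_eq _ _ _ hcard.symm).1 key
  refine ⟨q, e, c * lam, hq, ?_⟩
  rw [Matrix.mul_smul, inv_smul_eq_iff₀ hq, Matrix.mul_add, Matrix.mul_sub, Matrix.mul_smul,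
    Matrix.mul_smul, Matrix.mul_smul, pairIncidence_mul_onesMatrix hlam] at key2
  rw [Matrix.mul_sub, Matrix.mul_smul, Matrix.mul_smul, Matrix.mul_one, Matrix.mul_assoc W,
    ← key2, smul_smul, add_sub_cancel_right]

/-- The permutation of the `2`-subsets induced by a permutation of the points. -/
def pairPerm (σ : Equiv.Perm P) : Equiv.Perm {p : Finset P // p.card = 2} :=
  (Equiv.finsetCongr σ).subtypeEquiv fun p => by simp

/-- Let `M = 2I - eK`. The permuted matrix `Y` satisfies the same equation as `X = W Wᵀ`, because
`K`, `I` and `J` are permutation invariant. Evaluating `X M Y` in two ways gives `qX - cXJ = qY -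
cJY`, and `XJ = JY`; invertibility of `M` never enters. -/
theorem gram_submatrix_pairPerm [Fintype J] [DecidableEq J] {A : J → Finset P}
    {k s₁ s₂ lam : ℕ} (hJ : Fintype.card J = (Fintype.card P).choose 2)
    (hk : ∀ j, (A j).card = k) (hk2 : 2 ≤ k) (h₁ : s₁ < k) (h₂ : s₂ < k)
    (hi : ∀ i j, i ≠ j → (A i ∩ A j).card = s₁ ∨ (A i ∩ A j).card = s₂)
    (hlam : ∀ p : Finset P, p.card = 2 → (univ.filter (fun j => p ⊆ A j)).card = lam)
    (σ : Equiv.Perm P) :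
    (pairIncidence A * (pairIncidence A)ᵀ).submatrix (pairPerm σ) (pairPerm σ)
      = pairIncidence A * (pairIncidence A)ᵀ := by
  obtain ⟨q, e, c, hq, hX⟩ := exists_gram_equation hJ hk hk2 h₁ h₂ hi hlam
  set X := pairIncidence A * (pairIncidence A)ᵀ with hXdef
  set K := (pointPairIncidence P)ᵀ * pointPairIncidence P with hK
  have hKσ : K.submatrix (pairPerm σ) (pairPerm σ) = K := by
    ext p q
    simp only [hK, Matrix.submatrix_apply, Matrix.mul_apply, Matrix.transpose_apply,
      pointPairIncidence, Matrix.of_apply]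
    rw [← Equiv.sum_comp σ]
    refine Finset.sum_congr rfl fun x _ => ?_
    simp [pairPerm]
  have hXo : X * onesMatrix {p : Finset P // p.card = 2} {p : Finset P // p.card = 2}
      = ((k.choose 2 : ℕ) * lam : ℚ) • onesMatrix _ _ := by
    have : (pairIncidence A)ᵀ * onesMatrix {p : Finset P // p.card = 2} {p : Finset P // p.card = 2}
        = ((k.choose 2 : ℕ) : ℚ) • onesMatrix _ _ := by
      have := congrArg Matrix.transpose
        (onesMatrix_mul_pairIncidence (I := {p : Finset P // p.card = 2}) hk)
      rw [Matrix.transpose_mul] at this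
      exact this
    rw [hXdef, Matrix.mul_assoc, this, Matrix.mul_smul, pairIncidence_mul_onesMatrix hlam,
      smul_smul]
  have hXt : Xᵀ = X := by rw [hXdef, Matrix.transpose_mul, Matrix.transpose_transpose]
  have hKt : Kᵀ = K := by rw [hK, Matrix.transpose_mul, Matrix.transpose_transpose]
  set Y := X.submatrix (pairPerm σ) (pairPerm σ) with hY
  have hYt : Yᵀ = Y := by rw [hY, Matrix.transpose_submatrix, hXt]
  have hYeq : Y * ((2 : ℚ) • 1 - e • K) = q • 1 - c • onesMatrix _ _ := by
    have h := congrArg (fun M => Matrix.submatrix M (pairPerm σ) (pairPerm σ)) hX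
    beta_reduce at h
    rw [← Matrix.submatrix_mul_equiv _ _ _ (pairPerm σ) _] at h
    have h5 : ((2 : ℚ) • (1 : Matrix {p : Finset P // p.card = 2} _ ℚ) - e • K).submatrix
        (pairPerm σ) (pairPerm σ) = (2 : ℚ) • 1 - e • K := by
      conv_rhs => rw [← hKσ]
      ext; simp [Matrix.one_apply]
    rw [h5] at h
    rw [hY, h]
    ext; simp [Matrix.one_apply, onesMatrix]
  have hYo : onesMatrix {p : Finset P // p.card = 2} {p : Finset P // p.card = 2} * Y
      = ((k.choose 2 : ℕ) * lam : ℚ) • onesMatrix _ _ := by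
    have h := congrArg (fun M => (Matrix.submatrix M (pairPerm σ) (pairPerm σ))ᵀ) hXo
    beta_reduce at h
    rw [← Matrix.submatrix_mul_equiv _ _ _ (pairPerm σ) _, Matrix.transpose_mul, ← hY, hYt] at h
    exact h
  have hYeq' : ((2 : ℚ) • 1 - e • K) * Y = q • 1 - c • onesMatrix _ _ := by
    have h := congrArg Matrix.transpose hYeq
    rw [Matrix.transpose_mul, hYt] at h
    simp only [Matrix.transpose_sub, Matrix.transpose_smul, Matrix.transpose_one, hKt] at h
    exact h
  have h6 : X * (((2 : ℚ) • 1 - e • K) * Y) = (X * ((2 : ℚ) • 1 - e • K)) * Y :=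
    (Matrix.mul_assoc _ _ _).symm
  rw [hYeq', hX, Matrix.mul_sub, Matrix.sub_mul, Matrix.mul_smul, Matrix.mul_smul, hXo,
    Matrix.smul_mul, Matrix.smul_mul, hYo, Matrix.mul_one, Matrix.one_mul] at h6
  have h7 := sub_left_injective h6
  exact (smul_right_injective _ hq h7).symm

/-- A quasi-symmetric `2`-design on `v` points with `v.choose 2` blocks is a `4`-design. -/
theorem card_filter_subset_eq_of_tight [Fintype J] [DecidableEq J] {A : J → Finset P}
    {k s₁ s₂ lam : ℕ} (hJ : Fintype.card J = (Fintype.card P).choose 2)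
    (hk : ∀ j, (A j).card = k) (hk2 : 2 ≤ k) (h₁ : s₁ < k) (h₂ : s₂ < k)
    (hi : ∀ i j, i ≠ j → (A i ∩ A j).card = s₁ ∨ (A i ∩ A j).card = s₂)
    (hlam : ∀ p : Finset P, p.card = 2 → (univ.filter (fun j => p ⊆ A j)).card = lam)
    {T T' : Finset P} (hT : T.card = 4) (hT' : T'.card = 4) :
    (univ.filter (fun j => T ⊆ A j)).card = (univ.filter (fun j => T' ⊆ A j)).card := by
  obtain ⟨e⟩ : Nonempty ({x // x ∈ T} ≃ {x // x ∈ T'}) :=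
    ⟨Fintype.equivOfCardEq (by simp [hT, hT'])⟩
  set σ : Equiv.Perm P := e.extendSubtype with hσ
  have hmap : T.map σ.toEmbedding = T' := by
    refine Finset.eq_of_subset_of_card_le ?_ (by simp [hT, hT'])
    intro y hy
    obtain ⟨x, hx, rfl⟩ := Finset.mem_map.1 hy
    exact e.extendSubtype_mem x hx
  obtain ⟨p, hpT, hp⟩ := Finset.exists_subset_card_eq (show 2 ≤ T.card by omega)
  -- The entry of `W Wᵀ` at the two halves of `T` counts the blocks containing `T`.
  have hq : (T \ p).card = 2 := by rw [Finset.card_sdiff_of_subset hpT]; omega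
  have h := congrFun (congrFun (gram_submatrix_pairPerm hJ hk hk2 h₁ h₂ hi hlam σ) ⟨p, hp⟩)
    ⟨T \ p, hq⟩
  rw [Matrix.submatrix_apply, pairIncidence_mul_transpose, pairIncidence_mul_transpose] at h
  have h8 : ((pairPerm σ ⟨p, hp⟩ : Finset P) ∪ (pairPerm σ ⟨T \ p, hq⟩ : Finset P)) = T' := by
    rw [← hmap]
    conv_rhs => rw [← Finset.union_sdiff_of_subset hpT, Finset.map_union]
    rfl
  rw [h8] at h
  simp only [Finset.union_sdiff_of_subset hpT] at h
  exact_mod_cast h.symm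

end Tight

/-! ### Gram matrices, switching and the cut defined by an outside vector -/

section Algebra

open Finset

variable {F V : Type*} [Field F] [AddCommGroup V] [Module F V] {B : LinearMap.BilinForm F V}
  {a β : F}

/-- The scalar product of two vectors in terms of their scalar products with a basis all of whose
double products agree. -/
theorem bilin_eq_of_gram {ι : Type*} [Fintype ι] [DecidableEq ι] (hsymm : B.IsSymm)
    {v : ι → V} (hv : ∀ i j, B (v i) (v j) = if i = j then a else β)
    {w w' : V} {c x x' : ι → F} (hw : w = ∑ i, c i • v i)
    (hx : ∀ i, B w (v i) = β * x i) (hx' : ∀ i, B w' (v i) = β * x' i) :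
    (a - β) * (a + (Fintype.card ι - 1) * β) * B w w'
      = β ^ 2 * ((a + (Fintype.card ι - 1) * β) * ∑ i, x i * x' i
          - β * (∑ i, x i) * ∑ i, x' i) := by
  -- The linear system for the coordinates of `w` has matrix `(a - β)I + βJ`; summing its rows
  -- yields `∑ c`. The denominators of the inverse are kept multiplied out.
  have h1 : ∀ j, β * x j = c j * (a - β) + β * ∑ i, c i := by
    intro j
    rw [← hx, hw, LinearMap.BilinForm.sum_left]
    simp only [LinearMap.BilinForm.smul_left, hv]
    have : ∀ i, c i * (if i = j then a else β) = (if i = j then c i * (a - β) else 0) + β * c i := by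
      intro i; split_ifs <;> ring
    rw [Finset.sum_congr rfl (fun i _ => this i), Finset.sum_add_distrib, ← Finset.mul_sum]
    simp
  have h2 : B w w' = β * ∑ i, c i * x' i := by
    conv_lhs => rw [hw]
    rw [LinearMap.BilinForm.sum_left, Finset.mul_sum]
    refine Finset.sum_congr rfl fun i _ => ?_
    rw [LinearMap.BilinForm.smul_left, hsymm.eq (v i) w', hx']
    ring
  have h3 : β * ∑ i, x i = (a + (Fintype.card ι - 1) * β) * ∑ i, c i := by
    rw [Finset.mul_sum, Finset.sum_congr rfl (fun j _ => h1 j), Finset.sum_add_distrib,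
      ← Finset.sum_mul, Finset.sum_const, nsmul_eq_mul, Finset.card_univ]
    ring
  have h4 : (a - β) * ∑ i, c i * x' i = β * ∑ i, x i * x' i - β * (∑ i, c i) * ∑ i, x' i := by
    rw [Finset.mul_sum, Finset.mul_sum, Finset.mul_sum, ← Finset.sum_sub_distrib]
    refine Finset.sum_congr rfl fun i _ => ?_
    linear_combination (-x' i) * h1 i
  rw [h2]
  linear_combination ((a + (Fintype.card ι - 1) * β) * β) * h4 + (β ^ 2 * ∑ i, x' i) * h3

/-- This scalar is the eigenvalue of the Gram matrix at the all-ones vector. If it vanished, the sum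
of the basis would be orthogonal to everything, hence zero. -/
theorem gram_add_ne_zero {ι : Type*} [Fintype ι] [DecidableEq ι] [Nonempty ι]
    (hnondeg : B.Nondegenerate) {v : ι → V} (hv : ∀ i j, B (v i) (v j) = if i = j then a else β)
    (hind : LinearIndependent F v) (hspan : ⊤ ≤ Submodule.span F (Set.range v)) :
    a + (Fintype.card ι - 1) * β ≠ 0 := by
  intro h0
  have h1 : ∑ i, v i = 0 := by
    refine hnondeg.1 _ fun y => ?_
    obtain ⟨c, rfl⟩ := (Submodule.mem_span_range_iff_exists_fun F).1 (hspan (Submodule.mem_top (x := y)))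
    rw [map_sum]
    refine Finset.sum_eq_zero fun j _ => ?_
    rw [map_smul, LinearMap.BilinForm.sum_left]
    simp only [hv]
    have : ∀ i, (if i = j then a else β) = (if i = j then (a - β) else 0) + β := by
      intro i; split_ifs <;> ring
    rw [Finset.sum_congr rfl (fun i _ => this i), Finset.sum_add_distrib]
    simp only [Finset.sum_ite_eq', Finset.mem_univ, if_true, Finset.sum_const, nsmul_eq_mul,
      Finset.card_univ, smul_eq_mul]
    linear_combination (c j) * h0
  have := (Fintype.linearIndependent_iff.1 hind) (fun _ => 1) (by simpa using h1)
    (Classical.arbitrary ι)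
  exact one_ne_zero this

variable {n : ℕ} {Φ : Fin n → V}

/-- By symmetry of `B` the triple product does not depend on the order of the three vectors. -/
theorem mem_coherentTriples_iff (hsymm : B.IsSymm) {i j k : Fin n} (hij : i ≠ j) (hik : i ≠ k)
    (hjk : j ≠ k) : ({i, j, k} : Finset (Fin n)) ∈ coherentTriples B β Φ ↔
      tripleProduct B (Φ i) (Φ j) (Φ k) = -β ^ 3 := by
  have hcard : ({i, j, k} : Finset (Fin n)).card = 3 := Finset.card_eq_three.2
    ⟨i, j, k, hij, hik, hjk, rfl⟩
  simp only [coherentTriples, Finset.mem_filter, Finset.mem_powersetCard]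
  constructor
  · rintro ⟨-, i', j', k', h, ht⟩
    have hi : i' = i ∨ i' = j ∨ i' = k := by
      have : i' ∈ ({i, j, k} : Finset (Fin n)) := h ▸ by simp
      simpa using this
    have hj : j' = i ∨ j' = j ∨ j' = k := by
      have : j' ∈ ({i, j, k} : Finset (Fin n)) := h ▸ by simp
      simpa using this
    have hk : k' = i ∨ k' = j ∨ k' = k := by
      have : k' ∈ ({i, j, k} : Finset (Fin n)) := h ▸ by simp
      simpa using this
    have h1 : i' ≠ j' ∧ i' ≠ k' ∧ j' ≠ k' := by
      rw [h] at hcard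
      refine ⟨?_, ?_, ?_⟩ <;> rintro rfl
      · have := Finset.card_le_two (a := i') (b := k')
        simp at hcard; omega
      · have := Finset.card_le_two (a := i') (b := j')
        rw [Finset.insert_eq_of_mem (by simp)] at hcard
        have := Finset.card_le_two (a := j') (b := i')
        omega
      · have := Finset.card_le_two (a := i') (b := j')
        simp at hcard; omega
    obtain ⟨h1, h2, h3⟩ := h1
    rw [← ht]
    unfold tripleProduct
    have s1 := hsymm.eq (Φ i) (Φ j)
    have s2 := hsymm.eq (Φ i) (Φ k)
    have s3 := hsymm.eq (Φ j) (Φ k)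
    rcases hi with rfl | rfl | rfl <;> rcases hj with rfl | rfl | rfl <;>
      rcases hk with rfl | rfl | rfl <;> first | exact absurd rfl ‹_› | (simp only [s1, s2, s3]; try ring)
  · intro h
    exact ⟨⟨Finset.subset_univ _, hcard⟩, i, j, k, rfl, h⟩

theorem isIncoherent_iff {Γ : Finset (Fin n)} : IsIncoherent B β Φ Γ ↔
    ∀ i ∈ Γ, ∀ j ∈ Γ, ∀ k ∈ Γ, i ≠ j → j ≠ k → i ≠ k →
      tripleProduct B (Φ i) (Φ j) (Φ k) = β ^ 3 := by
  constructor
  · rintro (h | h)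
    · intro i hi j hj k hk hij hjk hik
      have := Finset.two_lt_card.2 ⟨i, hi, j, hj, k, hk, hij, hik, hjk⟩
      omega
    · exact h
  · exact Or.inr

theorem sum_sign_mul_sign {ι : Type*} [DecidableEq ι] {Γ A A' : Finset ι} (hA : A ⊆ Γ)
    (hA' : A' ⊆ Γ) :
    ∑ i ∈ Γ, (if i ∈ A then (1 : F) else -1) * (if i ∈ A' then (1 : F) else -1)
      = (Γ.card : F) - 2 * A.card - 2 * A'.card + 4 * (A ∩ A').card := by
  have h : ∀ S ⊆ Γ, (S.card : F) = ∑ i ∈ Γ, if i ∈ S then (1 : F) else 0 := by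
    intro S hS
    rw [← Finset.sum_filter, Finset.filter_mem_eq_inter, Finset.inter_eq_right.2 hS]
    simp
  rw [h A hA, h A' hA', h (A ∩ A') (Finset.inter_subset_left.trans hA), Finset.cast_card,
    Finset.mul_sum, Finset.mul_sum, Finset.mul_sum, ← Finset.sum_sub_distrib,
    ← Finset.sum_sub_distrib, ← Finset.sum_add_distrib]
  refine Finset.sum_congr rfl fun i _ => ?_
  by_cases h1 : i ∈ A <;> by_cases h2 : i ∈ A' <;> simp [h1, h2] <;> ring

theorem sum_sign {ι : Type*} [DecidableEq ι] {Γ A : Finset ι} (hA : A ⊆ Γ) :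
    ∑ i ∈ Γ, (if i ∈ A then (1 : F) else -1) = 2 * A.card - (Γ.card : F) := by
  have := sum_sign_mul_sign (F := F) hA (Finset.Subset.refl Γ)
  rw [Finset.inter_eq_left.2 hA] at this
  have h2 : ∑ i ∈ Γ, (if i ∈ A then (1 : F) else -1)
      = ∑ i ∈ Γ, (if i ∈ A then (1 : F) else -1) * (if i ∈ Γ then (1 : F) else -1) :=
    Finset.sum_congr rfl fun i hi => by simp [hi]
  rw [h2, this]; ring

theorem bilin_eq_or_neg (hsymm : B.IsSymm) (hΦ : IsEquiangular B a (β ^ 2) Φ) {j k : Fin n}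
    (h : j ≠ k) : B (Φ j) (Φ k) = β ∨ B (Φ j) (Φ k) = -β := by
  have := hΦ.double_product j k h
  rw [hsymm.eq (Φ k) (Φ j), ← sq] at this
  exact sq_eq_sq_iff_eq_or_eq_neg.1 this

/-- The vectors of an incoherent set can be multiplied by signs such that all their mutual scalar
products become `β`. -/
theorem exists_switching (hsymm : B.IsSymm) (hβ : β ≠ 0) (hΦ : IsEquiangular B a (β ^ 2) Φ)
    {Γ : Finset (Fin n)} (hΓ : IsIncoherent B β Φ Γ) (hne : Γ.Nonempty) :
    ∃ s : Fin n → F, (∀ i, s i = 1 ∨ s i = -1) ∧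
      ∀ i ∈ Γ, ∀ j ∈ Γ, i ≠ j → B (Φ i) (Φ j) = s i * s j * β := by
  obtain ⟨o, ho⟩ := hne
  -- Each vector is normalised to have product `β` with the base vector `o`; incoherence of the
  -- triples through `o` settles all other products.
  refine ⟨fun i => if i = o then 1 else B (Φ i) (Φ o) / β, ?_, ?_⟩
  · intro i
    dsimp only
    split_ifs with h
    · exact Or.inl rfl
    · rcases bilin_eq_or_neg hsymm hΦ h with h | h <;> rw [h]
      · left; field_simp
      · right; field_simp
  · intro i hi j hj hij
    dsimp only
    split_ifs with h1 h2 h2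
    · exact absurd (h1.trans h2.symm) hij
    · rw [h1, hsymm.eq (Φ o) (Φ j)]; field_simp
    · rw [h2]; field_simp
    · have h3 := isIncoherent_iff.1 hΓ i hi j hj o ho hij h2 h1
      unfold tripleProduct at h3
      rw [hsymm.eq (Φ o) (Φ i)] at h3
      have h4 := hΦ.double_product i j hij
      rw [hsymm.eq (Φ j) (Φ i)] at h4
      field_simp
      apply mul_left_cancel₀ (pow_ne_zero 2 hβ)
      linear_combination (B (Φ j) (Φ o) * B (Φ i) (Φ o)) * h4 - (B (Φ i) (Φ j)) * h3

/-- Every vector outside an incoherent basis cuts it into two parts; scalar products of vectors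
outside the basis are determined by how these parts intersect. -/
theorem exists_parts (hsymm : B.IsSymm) (hnondeg : B.Nondegenerate) (h2 : (2 : F) ≠ 0)
    (hβ : β ≠ 0) (hΦ : IsEquiangular B a (β ^ 2) Φ)
    {Γ : Finset (Fin n)} (hΓ : IsIncoherent B β Φ Γ) (hne : Γ.Nonempty)
    (hind : LinearIndependent F (fun i : Γ => Φ i))
    (hspan : ⊤ ≤ Submodule.span F (Set.range (fun i : Γ => Φ i))) :
    ∃ D : F, D ≠ 0 ∧ ∃ A : Fin n → Finset (Fin n),
      (∀ γ, A γ ⊆ Γ) ∧ (∀ γ, 2 * (A γ).card ≤ Γ.card) ∧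
      (∀ γ, γ ∉ Γ → ∀ α ∈ Γ, ∀ δ ∈ Γ,
        (({γ, α, δ} : Finset (Fin n)) ∈ coherentTriples B β Φ ↔ (α ∈ A γ ↔ δ ∉ A γ))) ∧
      ∀ γ, γ ∉ Γ → ∀ γ', γ' ∉ Γ → ∃ τ : F, (τ = 1 ∨ τ = -1) ∧ (γ = γ' → τ = 1) ∧
        (a - β) * D * (τ * B (Φ γ) (Φ γ')) = β ^ 2 *
          (D * ((Γ.card : F) - 2 * (A γ).card - 2 * (A γ').card + 4 * (A γ ∩ A γ').card)
            - β * (2 * (A γ).card - Γ.card) * (2 * (A γ').card - Γ.card)) := by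
  obtain ⟨s, hs, hsB⟩ := exists_switching hsymm hβ hΦ hΓ hne
  have hs2 : ∀ i, s i * s i = 1 := fun i => by rcases hs i with h | h <;> rw [h] <;> ring
  have hs0 : ∀ i, s i ≠ 0 := fun i h => by simpa [h] using hs2 i
  have hone : (1 : F) ≠ -1 := fun h => h2 (by linear_combination h)
  have : Nonempty Γ := hne.to_subtype
  obtain ⟨v, hvdef⟩ : ∃ v : Γ → V, v = fun i : Γ => s i • Φ i := ⟨_, rfl⟩
  have hv : ∀ i j, B (v i) (v j) = if i = j then a else β := by
    intro i j
    rw [hvdef, LinearMap.BilinForm.smul_left, LinearMap.BilinForm.smul_right]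
    split_ifs with h
    · subst h
      rw [hΦ.norm_eq]
      linear_combination a * hs2 i
    · rw [hsB i i.2 j j.2 (fun h' => h (Subtype.ext h'))]
      linear_combination β * (s j * s j * hs2 i + hs2 j)
  have hvunits : v = (fun i : Γ => Units.mk0 (s i) (hs0 i)) • (fun i : Γ => Φ i) := by
    rw [hvdef]; rfl
  have hvind : LinearIndependent F v := by
    rw [hvunits]; exact hind.units_smul _
  have hvspan : ⊤ ≤ Submodule.span F (Set.range v) := by
    refine hspan.trans (Submodule.span_le.2 ?_)
    rintro _ ⟨i, rfl⟩
    have : Φ i = s i • v i := by rw [hvdef, smul_smul, hs2, one_smul]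
    dsimp only
    rw [this]
    exact Submodule.smul_mem _ _ (Submodule.subset_span ⟨i, rfl⟩)
  have hD := gram_add_ne_zero hnondeg hv hvind hvspan
  rw [Fintype.card_coe] at hD
  -- For `γ ∉ Γ` and `i ∈ Γ`, `x γ i` is the sign of the product of `Φ γ` with the switched vector
  -- `v i`.
  obtain ⟨x, hxdef⟩ : ∃ x : Fin n → Fin n → F, x = fun γ i => s i * B (Φ γ) (Φ i) / β := ⟨_, rfl⟩
  have hx : ∀ γ, γ ∉ Γ → ∀ i ∈ Γ, x γ i = 1 ∨ x γ i = -1 := by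
    intro γ hγ i hi
    have hne : γ ≠ i := fun h => hγ (h ▸ hi)
    rw [hxdef]
    dsimp only
    rcases bilin_eq_or_neg hsymm hΦ hne with h | h <;> rcases hs i with h' | h' <;> rw [h, h'] <;>
      simp [hβ]
  have hxB : ∀ γ i, B (Φ γ) (Φ i) = β * (s i * x γ i) := by
    intro γ i
    rw [hxdef]
    field_simp
    linear_combination (-B (Φ γ) (Φ i)) * hs2 i
  classical
  obtain ⟨A, hA⟩ : ∃ A : Fin n → Finset (Fin n), A = fun γ =>
    if 2 * (Γ.filter (fun i => x γ i = 1)).card ≤ Γ.card then Γ.filter (fun i => x γ i = 1)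
      else Γ.filter (fun i => ¬ x γ i = 1) := ⟨_, rfl⟩
  have hAsub : ∀ γ, A γ ⊆ Γ := by
    intro γ; rw [hA]; dsimp only; split_ifs <;> exact Finset.filter_subset _ _
  -- The sign `σ` records whether `A γ` is the positive or the negative class, so `σ • Φ γ` is
  -- positive exactly on `A γ`. The `τ` of the statement is the product of two such signs.
  have hsign : ∀ γ, γ ∉ Γ → ∃ σ : F, (σ = 1 ∨ σ = -1) ∧
      ∀ i ∈ Γ, x γ i = σ * if i ∈ A γ then 1 else -1 := by
    intro γ hγ
    rw [hA]
    dsimp only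
    split_ifs with h
    · refine ⟨1, Or.inl rfl, fun i hi => ?_⟩
      rcases hx γ hγ i hi with h | h <;> simp [hi, h, hone.symm]
    · refine ⟨-1, Or.inr rfl, fun i hi => ?_⟩
      rcases hx γ hγ i hi with h | h <;> simp [hi, h, hone.symm]
  refine ⟨a + ((Γ.card : F) - 1) * β, hD, A, hAsub, ?_, ?_, ?_⟩
  · intro γ
    have := Finset.card_filter_add_card_filter_not (s := Γ) (fun i => x γ i = 1)
    rw [hA]
    dsimp only
    split_ifs <;> omega
  · intro γ hγ α hα δ hδ
    have hγα : γ ≠ α := fun h => hγ (h ▸ hα)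
    have hγδ : γ ≠ δ := fun h => hγ (h ▸ hδ)
    by_cases hαδ : α = δ
    · subst hαδ
      constructor
      · intro h
        have h3 : ({γ, α, α} : Finset (Fin n)).card = 3 := by
          simp only [coherentTriples, Finset.mem_filter, Finset.mem_powersetCard] at h
          exact h.1.2
        have := Finset.card_le_two (a := γ) (b := α)
        simp at h3; omega
      · intro h; tauto
    · rw [mem_coherentTriples_iff hsymm hγα hγδ hαδ]
      obtain ⟨σ, hσ, hσx⟩ := hsign γ hγ
      have : tripleProduct B (Φ γ) (Φ α) (Φ δ) = β ^ 3 * (x γ α * x γ δ) := by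
        unfold tripleProduct
        rw [hsymm.eq (Φ δ) (Φ γ), hxB γ α, hxB γ δ, hsB α hα δ hδ hαδ]
        linear_combination (β ^ 3 * x γ α * x γ δ) * (s δ * s δ * hs2 α + hs2 δ)
      have hσ2 : σ * σ = 1 := by rcases hσ with h | h <;> rw [h] <;> ring
      have h3 : x γ α * x γ δ = (if α ∈ A γ then 1 else -1) * (if δ ∈ A γ then 1 else -1) := by
        rw [hσx α hα, hσx δ hδ]
        linear_combination ((if α ∈ A γ then 1 else -1) * (if δ ∈ A γ then 1 else -1)) * hσ2
      rw [this, h3, mul_comm, show -β ^ 3 = -1 * β ^ 3 by ring,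
        mul_left_inj' (pow_ne_zero 3 hβ)]
      by_cases h4 : α ∈ A γ <;> by_cases h5 : δ ∈ A γ <;> simp [h4, h5, hone]
  · intro γ hγ γ' hγ'
    obtain ⟨σ, hσ, hσx⟩ := hsign γ hγ
    obtain ⟨σ', hσ', hσx'⟩ := hsign γ' hγ'
    have hσ2 : σ * σ = 1 := by rcases hσ with h | h <;> rw [h] <;> ring
    have hσ2' : σ' * σ' = 1 := by rcases hσ' with h | h <;> rw [h] <;> ring
    have hw : ∀ (γ : Fin n) (σ : F), σ * σ = 1 →
        (∀ i ∈ Γ, x γ i = σ * if i ∈ A γ then 1 else -1) →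
        ∀ i : Γ, B (σ • Φ γ) (v i) = β * if (i : Fin n) ∈ A γ then 1 else -1 := by
      intro γ σ hσ2 hσx i
      rw [hvdef, LinearMap.BilinForm.smul_left, LinearMap.BilinForm.smul_right, hxB, hσx i i.2]
      linear_combination (β * if (i : Fin n) ∈ A γ then 1 else -1) *
        (s i * s i * hσ2 + hs2 i)
    obtain ⟨c, hc⟩ := (Submodule.mem_span_range_iff_exists_fun F).1
      (hvspan (Submodule.mem_top (x := σ • Φ γ)))
    have key := bilin_eq_of_gram hsymm hv hc.symm (hw γ σ hσ2 hσx) (hw γ' σ' hσ2' hσx')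
    rw [Finset.sum_coe_sort Γ (fun i => (if i ∈ A γ then (1 : F) else -1) *
        (if i ∈ A γ' then 1 else -1)), Finset.sum_coe_sort Γ (fun i => if i ∈ A γ then (1 : F) else -1),
      Finset.sum_coe_sort Γ (fun i => if i ∈ A γ' then (1 : F) else -1),
      sum_sign_mul_sign (hAsub γ) (hAsub γ'), sum_sign (hAsub γ), sum_sign (hAsub γ'),
      Fintype.card_coe, LinearMap.BilinForm.smul_left, LinearMap.BilinForm.smul_right] at key
    refine ⟨σ * σ', ?_, ?_, ?_⟩
    · rcases hσ with h | h <;> rcases hσ' with h' | h' <;> rw [h, h'] <;> simp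
    · rintro rfl
      obtain ⟨i, hi⟩ := hne
      have h5 := (hσx i hi).symm.trans (hσx' i hi)
      have h6 : σ = σ' := by
        refine mul_right_cancel₀ ?_ h5
        split_ifs
        · exact one_ne_zero
        · exact neg_ne_zero.2 one_ne_zero
      rw [← h6, hσ2]
    · linear_combination key

end Algebra

/-! ### Coherent triples, cells and splittings in terms of cuts -/

section Cells

open Finset

variable {F V : Type*} [Field F] [AddCommGroup V] [Module F V] {B : LinearMap.BilinForm F V}
  {a β : F} {n : ℕ} {Φ : Fin n → V}

theorem card_of_mem_coherentTriples {T : Finset (Fin n)} (hT : T ∈ coherentTriples B β Φ) :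
    T.card = 3 := by
  simp only [coherentTriples, Finset.mem_filter, Finset.mem_powersetCard] at hT
  exact hT.1.2

/-- Products of distinct vectors are `±β`, so every triple product is `β ^ 3` or `-β ^ 3`, and these
differ since `2 ≠ 0`. -/
theorem isIncoherent_iff_not_subset (hsymm : B.IsSymm) (h2 : (2 : F) ≠ 0) (hβ : β ≠ 0)
    (hΦ : IsEquiangular B a (β ^ 2) Φ) {Γ : Finset (Fin n)} :
    IsIncoherent B β Φ Γ ↔ ∀ T ∈ coherentTriples B β Φ, ¬ T ⊆ Γ := by
  rw [isIncoherent_iff]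
  constructor
  · intro h T hT hTΓ
    obtain ⟨i, j, k, hij, hik, hjk, rfl⟩ := Finset.card_eq_three.1 (card_of_mem_coherentTriples hT)
    simp only [Finset.insert_subset_iff, Finset.singleton_subset_iff] at hTΓ
    have h1 := (mem_coherentTriples_iff hsymm hij hik hjk).1 hT
    have h3 := h i hTΓ.1 j hTΓ.2.1 k hTΓ.2.2 hij hjk hik
    exact mul_ne_zero h2 (pow_ne_zero 3 hβ) (by linear_combination h1 - h3)
  · intro h i hi j hj k hk hij hjk hik
    by_contra h1
    refine h _ ((mem_coherentTriples_iff hsymm hij hik hjk).2 ?_) (by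
      simp [Finset.insert_subset_iff, hi, hj, hk])
    unfold tripleProduct at h1 ⊢
    rcases bilin_eq_or_neg hsymm hΦ hij with e1 | e1 <;>
      rcases bilin_eq_or_neg hsymm hΦ hjk with e2 | e2 <;>
      rcases bilin_eq_or_neg hsymm hΦ hik.symm with e3 | e3 <;> rw [e1, e2, e3] at h1 ⊢ <;>
      first | ring1 | exact absurd (by ring1) h1

variable {Γ : Finset (Fin n)} {A : Fin n → Finset (Fin n)}

/-- A vector whose cut is trivial separates no pair, so adding it to `Γ` would keep the set
incoherent. -/
theorem nonempty_of_maximal (hsymm : B.IsSymm) (h2 : (2 : F) ≠ 0) (hβ : β ≠ 0)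
    (hΦ : IsEquiangular B a (β ^ 2) Φ) (hΓ : Maximal (IsIncoherent B β Φ) Γ)
    {γ : Fin n} (hγ : γ ∉ Γ) (hcoh : ∀ α ∈ Γ, ∀ δ ∈ Γ,
      (({γ, α, δ} : Finset (Fin n)) ∈ coherentTriples B β Φ ↔ (α ∈ A γ ↔ δ ∉ A γ))) :
    (A γ).Nonempty := by
  by_contra hA
  rw [Finset.not_nonempty_iff_eq_empty] at hA
  refine hγ (hΓ.le_of_ge (y := insert γ Γ) ?_ (Finset.subset_insert _ _)
    (Finset.mem_insert_self γ Γ))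
  rw [isIncoherent_iff_not_subset hsymm h2 hβ hΦ]
  intro T hT hTΓ
  by_cases hγT : γ ∈ T
  · have h1 := Finset.card_erase_of_mem hγT
    rw [card_of_mem_coherentTriples hT] at h1
    obtain ⟨α, δ, -, h3⟩ := Finset.card_eq_two.1 h1
    have h4 : T.erase γ ⊆ Γ := fun y hy =>
      (Finset.mem_insert.1 (hTΓ (Finset.mem_of_mem_erase hy))).resolve_left
        (Finset.ne_of_mem_erase hy)
    rw [← Finset.insert_erase hγT, h3] at hT
    rw [h3] at h4
    have := (hcoh α (h4 (by simp)) δ (h4 (by simp))).1 hT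
    simp [hA] at this
  · exact (isIncoherent_iff_not_subset hsymm h2 hβ hΦ).1 hΓ.prop T hT
      fun y hy => (Finset.mem_insert.1 (hTΓ hy)).resolve_left (fun h => hγT (h ▸ hy))

/-- The number of vectors separating two members of an incoherent set. -/
theorem card_separating (hinc : ∀ T ∈ coherentTriples B β Φ, ¬ T ⊆ Γ) {l m : ℕ}
    (hreg : IsRegularTwoGraph n l m (coherentTriples B β Φ))
    (hcoh : ∀ γ, γ ∉ Γ → ∀ α ∈ Γ, ∀ δ ∈ Γ,
      (({γ, α, δ} : Finset (Fin n)) ∈ coherentTriples B β Φ ↔ (α ∈ A γ ↔ δ ∉ A γ)))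
    {α δ : Fin n} (hα : α ∈ Γ) (hδ : δ ∈ Γ) (h : α ≠ δ) :
    (Γᶜ.filter (fun γ => α ∈ A γ ↔ δ ∉ A γ)).card = l := by
  rw [← hreg.isDesign.card_containing {α, δ} (Finset.subset_univ _) (Finset.card_pair h)]
  refine Finset.card_bij (fun γ _ => {γ, α, δ}) ?_ ?_ ?_
  · intro γ hγ
    obtain ⟨h1, h2⟩ := Finset.mem_filter.1 hγ
    exact Finset.mem_filter.2 ⟨(hcoh γ (Finset.mem_compl.1 h1) α hα δ hδ).2 h2,
      Finset.subset_insert _ _⟩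
  · intro γ hγ γ' hγ' heq
    have h1 := Finset.mem_compl.1 (Finset.mem_filter.1 hγ).1
    have : γ ∈ ({γ', α, δ} : Finset (Fin n)) := heq ▸ Finset.mem_insert_self _ _
    simp only [Finset.mem_insert, Finset.mem_singleton] at this
    rcases this with h2 | rfl | rfl
    · exact h2
    · exact absurd hα h1
    · exact absurd hδ h1
  · intro T hT
    obtain ⟨h1, h2⟩ := Finset.mem_filter.1 hT
    have h3 := card_of_mem_coherentTriples h1
    have h4 : (T \ {α, δ}).card = 1 := by
      rw [Finset.card_sdiff_of_subset h2, Finset.card_pair h, h3]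
    obtain ⟨γ, h5⟩ := Finset.card_eq_one.1 h4
    have h6 : T = {γ, α, δ} := by
      rw [← Finset.sdiff_union_of_subset h2, h5]; rfl
    -- The third vertex cannot lie in `Γ`, which contains no coherent triple; so all `l` triples
    -- through the pair are counted outside.
    have h7 : γ ∉ Γ := fun hγ => hinc T h1 (by
      rw [h6]; simp [Finset.insert_subset_iff, hα, hδ, hγ])
    refine ⟨γ, Finset.mem_filter.2 ⟨Finset.mem_compl.2 h7, ?_⟩, h6.symm⟩
    rw [← hcoh γ h7 α hα δ hδ, ← h6]
    exact h1

theorem cell_eq {γ : Fin n} (hsub : A γ ⊆ Γ)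
    (hcoh : ∀ α ∈ Γ, ∀ δ ∈ Γ,
      (({γ, α, δ} : Finset (Fin n)) ∈ coherentTriples B β Φ ↔ (α ∈ A γ ↔ δ ∉ A γ)))
    {α : Fin n} (hα : α ∈ Γ) : cell B β Φ Γ γ α = if α ∈ A γ then Γ \ A γ else A γ := by
  ext δ
  simp only [cell, Finset.mem_filter]
  have := @hsub δ
  split_ifs with h
  · rw [Finset.mem_sdiff]
    refine and_congr_right fun hδ => ?_
    rw [hcoh α hα δ hδ]; tauto
  · refine ⟨fun hδ => ?_, fun hδ => ⟨this hδ, ?_⟩⟩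
    · have := (hcoh α hα δ hδ.1).1 hδ.2; tauto
    · rw [hcoh α hα δ (this hδ)]; tauto

/-- The cell of `α` is the part opposite to `α`. Nonemptiness of both parts supplies the
representatives `α₁`, `α₂`. -/
theorem isSplitting_iff {γ : Fin n} (hsub : A γ ⊆ Γ) (hne : (A γ).Nonempty)
    (hne' : (Γ \ A γ).Nonempty)
    (hcoh : ∀ α ∈ Γ, ∀ δ ∈ Γ,
      (({γ, α, δ} : Finset (Fin n)) ∈ coherentTriples B β Φ ↔ (α ∈ A γ ↔ δ ∉ A γ)))
    {A₁ A₂ : Finset (Fin n)} : IsSplitting B β Φ Γ γ A₁ A₂ ↔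
      ((A₁ = A γ ∧ A₂ = Γ \ A γ) ∨ (A₁ = Γ \ A γ ∧ A₂ = A γ)) ∧ A₁.card ≤ A₂.card := by
  constructor
  · rintro ⟨α₁, h₁, α₂, h₂, hc, e1, e2, hle⟩
    refine ⟨?_, hle⟩
    rw [hcoh α₁ h₁ α₂ h₂] at hc
    rw [cell_eq hsub hcoh h₁] at e1
    rw [cell_eq hsub hcoh h₂] at e2
    by_cases h : α₁ ∈ A γ
    · rw [if_pos h] at e1
      rw [if_neg (hc.1 h)] at e2
      exact Or.inr ⟨e1, e2⟩
    · rw [if_neg h] at e1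
      rw [if_pos (by tauto)] at e2
      exact Or.inl ⟨e1, e2⟩
  · obtain ⟨x, hx⟩ := hne
    obtain ⟨y, hy⟩ := hne'
    obtain ⟨hyΓ, hy⟩ := Finset.mem_sdiff.1 hy
    rintro ⟨⟨rfl, rfl⟩ | ⟨rfl, rfl⟩, hle⟩
    · refine ⟨y, hyΓ, x, hsub hx, ?_, ?_, ?_, hle⟩
      · rw [hcoh y hyΓ x (hsub hx)]; tauto
      · rw [cell_eq hsub hcoh hyΓ, if_neg hy]
      · rw [cell_eq hsub hcoh (hsub hx), if_pos hx]
    · refine ⟨x, hsub hx, y, hyΓ, ?_, ?_, ?_, hle⟩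
      · rw [hcoh x (hsub hx) y hyΓ]; tauto
      · rw [cell_eq hsub hcoh (hsub hx), if_pos hx]
      · rw [cell_eq hsub hcoh hyΓ, if_neg hy]

end Cells

/-! ### From indexed families to designs -/

section Design

open Finset

theorem isDesign_image {κ P : Type*} [DecidableEq P] {C : Finset κ} {A : κ → Finset P}
    {Γ : Finset P} {t d k lam : ℕ} (hinj : Set.InjOn A C) (hd : Γ.card = d)
    (hsub : ∀ γ ∈ C, A γ ⊆ Γ) (hk : ∀ γ ∈ C, (A γ).card = k)
    (hlam : ∀ T ⊆ Γ, T.card = t → (C.filter (fun γ => T ⊆ A γ)).card = lam) :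
    IsDesign t d k lam Γ (C.image A) where
  card_points := hd
  block_subset := by
    intro S hS
    obtain ⟨γ, hγ, rfl⟩ := Finset.mem_image.1 hS
    exact hsub γ hγ
  card_block := by
    intro S hS
    obtain ⟨γ, hγ, rfl⟩ := Finset.mem_image.1 hS
    exact hk γ hγ
  card_containing := by
    intro T hT ht
    rw [Finset.filter_image, Finset.card_image_of_injOn, hlam T hT ht]
    exact hinj.mono (Finset.coe_subset.2 (Finset.filter_subset _ _))

theorem isDesign_two_image {κ P : Type*} [DecidableEq P] {C : Finset κ} {A : κ → Finset P}
    {Γ : Finset P} {d k lam : ℕ} (hinj : Set.InjOn A C) (hd : Γ.card = d)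
    (hsub : ∀ γ ∈ C, A γ ⊆ Γ) (hk : ∀ γ ∈ C, (A γ).card = k)
    (hlam : ∀ α ∈ Γ, ∀ δ ∈ Γ, α ≠ δ →
      (C.filter (fun γ => α ∈ A γ ∧ δ ∈ A γ)).card = lam) :
    IsDesign 2 d k lam Γ (C.image A) := by
  refine isDesign_image hinj hd hsub hk fun T hT ht => ?_
  obtain ⟨α, δ, h, rfl⟩ := Finset.card_eq_two.1 ht
  simp only [Finset.insert_subset_iff, Finset.singleton_subset_iff] at hT ⊢
  exact hlam α hT.1 δ hT.2 h

/-- The tight case of quasi-symmetric designs, for families of subsets of a finite set. -/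
theorem exists_isDesign_four {κ P : Type*} [DecidableEq κ] [DecidableEq P] {C : Finset κ}
    {A : κ → Finset P} {Γ : Finset P} {d k s₁ s₂ lam : ℕ} (hinj : Set.InjOn A C)
    (hd : Γ.card = d) (hsub : ∀ γ ∈ C, A γ ⊆ Γ) (hk : ∀ γ ∈ C, (A γ).card = k)
    (hC : C.card = d.choose 2) (hk2 : 2 ≤ k) (h₁ : s₁ < k) (h₂ : s₂ < k)
    (hi : ∀ γ ∈ C, ∀ γ' ∈ C, γ ≠ γ' → (A γ ∩ A γ').card = s₁ ∨ (A γ ∩ A γ').card = s₂)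
    (hlam : ∀ α ∈ Γ, ∀ δ ∈ Γ, α ≠ δ →
      (C.filter (fun γ => α ∈ A γ ∧ δ ∈ A γ)).card = lam) :
    ∃ lam₄, IsDesign 4 d k lam₄ Γ (C.image A) := by
  obtain ⟨f, hf⟩ : ∃ f : C → Finset Γ, f = fun γ : C => (A γ).subtype (· ∈ Γ) := ⟨_, rfl⟩
  have hsubset : ∀ (T : Finset Γ) (γ : C),
      T ⊆ f γ ↔ T.map (Function.Embedding.subtype _) ⊆ A γ := by
    intro T γ
    rw [hf]
    constructor
    · intro h x hx
      obtain ⟨y, hy, rfl⟩ := Finset.mem_map.1 hx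
      exact Finset.mem_subtype.1 (h hy)
    · intro h x hx
      exact Finset.mem_subtype.2 (h (Finset.mem_map_of_mem (Function.Embedding.subtype _) hx))
  have hcount : ∀ T : Finset Γ, (univ.filter (fun γ : C => T ⊆ f γ)).card
      = (C.filter (fun γ => T.map (Function.Embedding.subtype _) ⊆ A γ)).card := by
    intro T
    simp only [hsubset, Finset.card_filter]
    exact Finset.sum_coe_sort C
      (fun γ => if T.map (Function.Embedding.subtype _) ⊆ A γ then 1 else 0)
  have hcardf : ∀ S : Finset P, S ⊆ Γ → (S.subtype (· ∈ Γ)).card = S.card := by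
    intro S hS
    rw [Finset.card_subtype, Finset.filter_true_of_mem hS]
  have hmap : ∀ S : Finset P, S ⊆ Γ →
      (S.subtype (· ∈ Γ)).map (Function.Embedding.subtype _) = S := by
    intro S hS
    rw [Finset.subtype_map, Finset.filter_true_of_mem hS]
  have key := fun T T' => card_filter_subset_eq_of_tight (A := f) (k := k) (s₁ := s₁) (s₂ := s₂)
    (lam := lam) (T := T) (T' := T') (by simp [hC, hd])
    (fun γ => by rw [hf]; dsimp only; rw [hcardf _ (hsub _ γ.2), hk _ γ.2]) hk2 h₁ h₂
    (fun γ γ' h => by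
      have h3 : f γ ∩ f γ' = (A γ ∩ A γ').subtype (· ∈ Γ) := by
        rw [hf]; ext; simp
      rw [h3, hcardf _ (Finset.inter_subset_left.trans (hsub _ γ.2))]
      exact hi γ γ.2 γ' γ'.2 (fun h' => h (Subtype.ext h')))
    (fun p hp => by
      obtain ⟨α, δ, h, rfl⟩ := Finset.card_eq_two.1 hp
      rw [hcount, ← hlam α α.2 δ δ.2 (fun h' => h (Subtype.ext h'))]
      simp [Finset.insert_subset_iff])
  by_cases hex : ∃ T₀ ⊆ Γ, T₀.card = 4
  · obtain ⟨T₀, hT₀, h4⟩ := hex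
    refine ⟨(C.filter (fun γ => T₀ ⊆ A γ)).card,
      isDesign_image hinj hd hsub hk (fun T hT ht => ?_)⟩
    have := key (T.subtype (· ∈ Γ)) (T₀.subtype (· ∈ Γ)) (by rw [hcardf _ hT, ht])
      (by rw [hcardf _ hT₀, h4])
    rwa [hcount, hcount, hmap _ hT, hmap _ hT₀] at this
  · exact ⟨0, isDesign_image hinj hd hsub hk (fun T hT ht => absurd ⟨T, hT, ht⟩ hex)⟩

end Design

/-! ### Designs from a constant number of separating blocks -/

section Families

open Finset

variable {κ P : Type*} [DecidableEq P] {C : Finset κ} {A : κ → Finset P}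
  {Γ : Finset P} {d k l : ℕ}

theorem exists_pair_count (hsub : ∀ γ ∈ C, A γ ⊆ Γ) (hk : ∀ γ ∈ C, (A γ).card = k)
    (hd : Γ.card = d) (hd2 : 2 ≤ d) (hne : d ≠ 2 * k) (hkd : k < d)
    (hl : ∀ α ∈ Γ, ∀ δ ∈ Γ, α ≠ δ → (C.filter (fun γ => α ∈ A γ ↔ δ ∉ A γ)).card = l) :
    ∃ lam : ℕ, 2 * ((d : ℤ) - k) * lam = l * (k - 1) ∧ ∀ α ∈ Γ, ∀ δ ∈ Γ, α ≠ δ →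
      (C.filter (fun γ => α ∈ A γ ∧ δ ∈ A γ)).card = lam := by
  obtain ⟨α, hα, δ, hδ, h⟩ := Finset.one_lt_card.1 (show 1 < Γ.card by omega)
  have h1 := two_mul_card_filter_mem_and hsub hk hd hne hl hα hδ h
  refine ⟨_, h1, fun α' hα' δ' hδ' h' => ?_⟩
  have h2 := two_mul_card_filter_mem_and hsub hk hd hne hl hα' hδ' h'
  have h3 : 2 * ((d : ℤ) - k) ≠ 0 := by omega
  exact_mod_cast mul_left_cancel₀ h3 (h2.trans h1.symm)

/-- The replication number `r` is constant, and counting incidences gives `d r = d k`. -/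
theorem card_filter_mem_eq_of_square (hsub : ∀ γ ∈ C, A γ ⊆ Γ)
    (hk : ∀ γ ∈ C, (A γ).card = k) (hd : Γ.card = d) (hC : C.card = d) (hd2 : 2 ≤ d)
    (hne : d ≠ 2 * k) (hkd : k < d)
    (hl : ∀ α ∈ Γ, ∀ δ ∈ Γ, α ≠ δ → (C.filter (fun γ => α ∈ A γ ↔ δ ∉ A γ)).card = l) :
    ((d : ℤ) - 1) * l = 2 * (d - k) * k ∧
      ∀ α ∈ Γ, (C.filter (fun γ => α ∈ A γ)).card = k := by
  have h1 := fun α hα => two_mul_card_filter_mem hsub hk hd hne hl (α := α) hα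
  have h2 := sum_card_filter_mem hsub hk
  have h3 := Finset.sum_congr (s₁ := Γ) rfl h1
  rw [← Finset.mul_sum, h2, hC] at h3
  simp only [Finset.sum_const, hd, nsmul_eq_mul] at h3
  have hd0 : (d : ℤ) ≠ 0 := by omega
  have h4 : ((d : ℤ) - 1) * l = 2 * (d - k) * k := by
    apply mul_left_cancel₀ hd0
    linear_combination -h3
  refine ⟨h4, fun α hα => ?_⟩
  have h5 : 2 * ((d : ℤ) - k) ≠ 0 := by omega
  exact_mod_cast mul_left_cancel₀ h5 ((h1 α hα).trans h4)

/-- Too many blocks force both intersection numbers to occur. -/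
theorem exists_card_inter_eq {F : Type*} [Field F] (hsub : ∀ γ ∈ C, A γ ⊆ Γ)
    (hk : ∀ γ ∈ C, (A γ).card = k) (hCΓ : Γ.card < C.card) (hΓ : 2 ≤ Γ.card)
    (hcast : ∀ x y : ℕ, x ≤ Γ.card → y ≤ Γ.card → (x : F) = y → x = y) {e e' : F}
    (hlt : ∀ γ ∈ C, ∀ γ' ∈ C, γ ≠ γ' → (A γ ∩ A γ').card < k)
    (he : ∀ γ ∈ C, ∀ γ' ∈ C, γ ≠ γ' →
      ((A γ ∩ A γ').card : F) = e ∨ ((A γ ∩ A γ').card : F) = e') :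
    ∃ γ ∈ C, ∃ γ' ∈ C, γ ≠ γ' ∧ ((A γ ∩ A γ').card : F) = e := by
  by_contra hcon
  push Not at hcon
  have h1 : ∀ γ ∈ C, ∀ γ' ∈ C, γ ≠ γ' → ((A γ ∩ A γ').card : F) = e' :=
    fun γ hγ γ' hγ' h => (he γ hγ γ' hγ' h).resolve_left (hcon γ hγ γ' hγ' h)
  have hle : ∀ γ ∈ C, ∀ γ', (A γ ∩ A γ').card ≤ Γ.card := fun γ hγ γ' =>
    Finset.card_le_card (Finset.inter_subset_left.trans (hsub γ hγ))
  obtain ⟨γ, hγ, γ', hγ', h⟩ := Finset.one_lt_card.1 (show 1 < C.card by omega)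
  have := card_le_of_card_inter_eq hsub hk (hlt γ hγ γ' hγ' h)
    (fun x hx y hy hxy => hcast _ _ (hle x hx y) (hle γ hγ γ')
      ((h1 x hx y hy hxy).trans (h1 γ hγ γ' hγ' h).symm))
  omega

/-- Blocks together with their complements, for blocks of half the size. -/
theorem isDesign_union_compl (hsub : ∀ γ ∈ C, A γ ⊆ Γ) (hk : ∀ γ ∈ C, (A γ).card = k)
    (hd : Γ.card = 2 * k) (hinj : Set.InjOn A C)
    (hinj' : ∀ γ ∈ C, ∀ γ' ∈ C, A γ ≠ Γ \ A γ') {lam : ℕ} (hlam : lam + l = C.card)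
    (hl : ∀ α ∈ Γ, ∀ δ ∈ Γ, α ≠ δ → (C.filter (fun γ => α ∈ A γ ↔ δ ∉ A γ)).card = l) :
    IsDesign 2 (2 * k) k lam Γ (C.image A ∪ C.image (fun γ => Γ \ A γ)) := by
  have hinj₂ : Set.InjOn (fun γ => Γ \ A γ) C := by
    intro γ hγ γ' hγ' h
    refine hinj hγ hγ' ?_
    rw [← Finset.sdiff_sdiff_eq_self (hsub γ hγ), ← Finset.sdiff_sdiff_eq_self (hsub γ' hγ')]
    exact congrArg (Γ \ ·) h
  refine ⟨hd, ?_, ?_, ?_⟩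
  · intro S hS
    rcases Finset.mem_union.1 hS with hS | hS <;> obtain ⟨γ, hγ, rfl⟩ := Finset.mem_image.1 hS
    · exact hsub γ hγ
    · exact Finset.sdiff_subset
  · intro S hS
    rcases Finset.mem_union.1 hS with hS | hS <;> obtain ⟨γ, hγ, rfl⟩ := Finset.mem_image.1 hS
    · exact hk γ hγ
    · rw [Finset.card_sdiff_of_subset (hsub γ hγ), hk γ hγ]; omega
  · intro T hT ht
    obtain ⟨α, δ, h, rfl⟩ := Finset.card_eq_two.1 ht
    simp only [Finset.insert_subset_iff, Finset.singleton_subset_iff] at hT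
    have hdisj : Disjoint (C.image A) (C.image (fun γ => Γ \ A γ)) := by
      rw [Finset.disjoint_left]
      rintro S hS hS'
      obtain ⟨γ, hγ, rfl⟩ := Finset.mem_image.1 hS
      obtain ⟨γ', hγ', h⟩ := Finset.mem_image.1 hS'
      exact hinj' γ hγ γ' hγ' h.symm
    rw [Finset.filter_union, Finset.card_union_of_disjoint
      (Finset.disjoint_filter_filter hdisj), Finset.filter_image, Finset.filter_image,
      Finset.card_image_of_injOn (hinj.mono (Finset.coe_subset.2 (Finset.filter_subset _ _))),
      Finset.card_image_of_injOn (hinj₂.mono (Finset.coe_subset.2 (Finset.filter_subset _ _)))]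
    have h1 := hl α hT.1 δ hT.2 h
    -- Each `γ` has the pair inside its block, inside the complement, or separated.
    have h2 : (C.filter (fun γ => {α, δ} ⊆ A γ)).card + (C.filter (fun γ => {α, δ} ⊆ Γ \ A γ)).card
        + (C.filter (fun γ => α ∈ A γ ↔ δ ∉ A γ)).card = C.card := by
      rw [Finset.card_eq_sum_ones C]
      simp only [Finset.card_filter, ← Finset.sum_add_distrib]
      refine Finset.sum_congr rfl fun γ _ => ?_
      by_cases h3 : α ∈ A γ <;> by_cases h4 : δ ∈ A γ <;>
        simp [Finset.insert_subset_iff, hT, h3, h4]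
    omega

end Families

/-! ### Passing between equations in the field and natural numbers -/

section Field

open Finset

variable {F : Type*} [Field F] {a β D : F}

/-- Subtracting the two equations cancels the terms with `(2k - d)²`, after which `D` divides out.
-/
theorem sub_mul_sub_eq (hD : D ≠ 0) {d k t ε : F}
    (hdiag : (a - β) * D * a = β ^ 2 * (D * (d - 2 * k - 2 * k + 4 * k)
      - β * (2 * k - d) * (2 * k - d)))
    (hoff : (a - β) * D * (ε * β) = β ^ 2 * (D * (d - 2 * k - 2 * k + 4 * t)
      - β * (2 * k - d) * (2 * k - d))) :
    (a - β) * (a - ε * β) = 4 * β ^ 2 * (k - t) := by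
  apply mul_left_cancel₀ hD
  linear_combination hdiag - hoff

theorem eq_sub_of_sub_mul_sub (hβ : β ≠ 0) (h4 : (4 : F) ≠ 0) {k t ε : F}
    (hε : ε = 1 ∨ ε = -1) (h : (a - β) * (a - ε * β) = 4 * β ^ 2 * (k - t)) :
    t = k - (a * β⁻¹ - 1) ^ 2 / 4 ∨ t = k - ((a * β⁻¹) ^ 2 - 1) / 4 := by
  rcases hε with rfl | rfl
  · left
    field_simp
    linear_combination h
  · right
    field_simp
    linear_combination h

theorem natCast_eq_of_le {p d : ℕ} [CharP F p] (hp : d < p) {x y : ℕ} (hx : x ≤ d) (hy : y ≤ d)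
    (h : (x : F) = y) : x = y :=
  CharP.natCast_injOn_Iio F p (Set.mem_Iio.2 (by omega)) (Set.mem_Iio.2 (by omega)) h

theorem isLeast_of_natCast_eq {p d : ℕ} [CharP F p] (hp : d < p) {s : ℕ} (hs : s ≤ d) {e : F}
    (h : (s : F) = e) : IsLeast {s : ℕ | (s : F) = e} s := by
  refine ⟨h, fun x hx => ?_⟩
  by_contra hlt
  have := natCast_eq_of_le hp (by omega) hs ((show (x : F) = e from hx).trans h.symm)
  omega

/-- The difference of the equations factors as `(k - k')(k + k' - d)` up to a unit. As both sizes
are at most `d/2`, the second factor vanishes only for `k = k' = d/2`. -/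
theorem card_eq_of_norm_eq {p d : ℕ} [CharP F p] (hp : d < p) (h2 : (2 : F) ≠ 0) (hβ : β ≠ 0)
    {k k' : ℕ} (hk : 2 * k ≤ d) (hk' : 2 * k' ≤ d)
    (h : (a - β) * D * a = β ^ 2 * (D * ((d : F) - 2 * k - 2 * k + 4 * k)
      - β * (2 * k - d) * (2 * k - d)))
    (h' : (a - β) * D * a = β ^ 2 * (D * ((d : F) - 2 * k' - 2 * k' + 4 * k')
      - β * (2 * k' - d) * (2 * k' - d))) : k = k' := by
  have h1 : (((k : F) - k') * (k + k' - d)) = 0 := by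
    have h3 : 2 * 2 * β ^ 3 ≠ 0 := mul_ne_zero (mul_ne_zero h2 h2) (pow_ne_zero 3 hβ)
    apply mul_left_cancel₀ h3
    linear_combination h - h'
  rcases mul_eq_zero.1 h1 with h1 | h1
  · exact natCast_eq_of_le (F := F) hp (by omega) (by omega) (sub_eq_zero.1 h1)
  · have := natCast_eq_of_le (F := F) hp (x := k + k') (y := d) (by omega) le_rfl
      (by push_cast; exact sub_eq_zero.1 h1)
    omega

end Field

/-! ### The case of unequal part sizes -/

section Assembly

open Finset

/-- The combinatorial conclusions for blocks of size different from half the number of points. -/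
theorem designs_of_ne {F P : Type*} [Field F] [DecidableEq P] {p n d l k : ℕ} [CharP F p]
    (hp : d < p) {C Γ : Finset P} {A : P → Finset P} (hd : Γ.card = d) (hC : C.card + d = n)
    (hk1 : 1 ≤ k) (hkd : 2 * k < d) (hsub : ∀ γ ∈ C, A γ ⊆ Γ) (hk : ∀ γ ∈ C, (A γ).card = k)
    (hl : ∀ α ∈ Γ, ∀ δ ∈ Γ, α ≠ δ → (C.filter (fun γ => α ∈ A γ ↔ δ ∉ A γ)).card = l)
    (hinj : Set.InjOn A C) {e₁ e₂ : F} (he : e₁ ≠ e₂)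
    (hint : ∀ γ ∈ C, ∀ γ' ∈ C, γ ≠ γ' →
      ((A γ ∩ A γ').card : F) = e₁ ∨ ((A γ ∩ A γ').card : F) = e₂) :
    ∃ lam₁ lam₂ : ℕ,
      (lam₁ : ℚ) = (l : ℚ) * ((k : ℚ) - 1) / (2 * ((d - k : ℕ) : ℚ)) ∧
      (lam₂ : ℚ) = (l : ℚ) * (((d - k : ℕ) : ℚ) - 1) / (2 * (k : ℚ)) ∧
      IsDesign 2 d k lam₁ Γ (C.image A) ∧
      IsDesign 2 d (d - k) lam₂ Γ (C.image (fun γ => Γ \ A γ)) ∧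
      (2 * d < n → ∃ s₁ s₂ : ℕ, IsLeast {s : ℕ | (s : F) = e₁} s₁ ∧
        IsLeast {s : ℕ | (s : F) = e₂} s₂ ∧
        IsQuasiSymmetricDesign d k lam₁ (min s₁ s₂) (max s₁ s₂) Γ (C.image A)) ∧
      (2 * n = d * (d + 1) → ∃ lam : ℕ, IsDesign 4 d k lam Γ (C.image A)) ∧
      (n = 2 * d → ∃ s : ℕ,
        (IsLeast {s : ℕ | (s : F) = e₁} s ∨ IsLeast {s : ℕ | (s : F) = e₂} s) ∧
        IsSymmetricDesign d k lam₁ s Γ (C.image A)) := by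
  classical
  have hsub' : ∀ γ ∈ C, Γ \ A γ ⊆ Γ := fun γ _ => Finset.sdiff_subset
  have hk' : ∀ γ ∈ C, (Γ \ A γ).card = d - k := fun γ hγ => by
    rw [Finset.card_sdiff_of_subset (hsub γ hγ), hk γ hγ, hd]
  have hl' : ∀ α ∈ Γ, ∀ δ ∈ Γ, α ≠ δ →
      (C.filter (fun γ => α ∈ Γ \ A γ ↔ δ ∉ Γ \ A γ)).card = l := by
    intro α hα δ hδ h
    rw [← hl α hα δ hδ h]
    congr 1
    refine Finset.filter_congr fun γ _ => ?_
    simp only [Finset.mem_sdiff, hα, hδ]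
    tauto
  have hinj' : Set.InjOn (fun γ => Γ \ A γ) C := by
    intro γ hγ γ' hγ' h
    refine hinj hγ hγ' ?_
    rw [← Finset.sdiff_sdiff_eq_self (hsub γ hγ), ← Finset.sdiff_sdiff_eq_self (hsub γ' hγ')]
    exact congrArg (Γ \ ·) h
  obtain ⟨lam₁, hlam₁, hpair₁⟩ := exists_pair_count hsub hk hd (by omega) (by omega) (by omega) hl
  obtain ⟨lam₂, hlam₂, hpair₂⟩ := exists_pair_count hsub' hk' hd (by omega) (by omega) (by omega)
    hl'
  have hdes := isDesign_two_image hinj hd hsub hk hpair₁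
  have hcast := fun x y : ℕ => natCast_eq_of_le (F := F) (d := d) hp (x := x) (y := y)
  have hle : ∀ γ ∈ C, ∀ γ', (A γ ∩ A γ').card ≤ d := fun γ hγ γ' =>
    hd ▸ Finset.card_le_card (Finset.inter_subset_left.trans (hsub γ hγ))
  have hlt : ∀ γ ∈ C, ∀ γ' ∈ C, γ ≠ γ' → (A γ ∩ A γ').card < k := by
    intro γ hγ γ' hγ' h
    by_contra hge
    have h1 : A γ ∩ A γ' = A γ := Finset.eq_of_subset_of_card_le Finset.inter_subset_left
      (by rw [hk γ hγ]; omega)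
    have h2 : A γ ∩ A γ' = A γ' := Finset.eq_of_subset_of_card_le Finset.inter_subset_right
      (by rw [hk γ' hγ']; omega)
    exact h (hinj hγ hγ' (h1.symm.trans h2))
  have hquasi : 2 * d < n → ∃ s₁ s₂ : ℕ, s₁ < k ∧ s₂ < k ∧ (s₁ : F) = e₁ ∧ (s₂ : F) = e₂ ∧
      (∃ γ ∈ C, ∃ γ' ∈ C, γ ≠ γ' ∧ (A γ ∩ A γ').card = s₁) ∧
      (∃ γ ∈ C, ∃ γ' ∈ C, γ ≠ γ' ∧ (A γ ∩ A γ').card = s₂) ∧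
      (∀ γ ∈ C, ∀ γ' ∈ C, γ ≠ γ' → (A γ ∩ A γ').card = s₁ ∨ (A γ ∩ A γ').card = s₂) := by
    intro hn
    obtain ⟨γ₁, h₁, γ₁', h₁', hne₁, hs₁⟩ := exists_card_inter_eq hsub hk (by omega) (by omega)
      (by rw [hd]; exact hcast) hlt hint
    obtain ⟨γ₂, h₂, γ₂', h₂', hne₂, hs₂⟩ := exists_card_inter_eq hsub hk (by omega) (by omega)
      (by rw [hd]; exact hcast) hlt (fun γ hγ γ' hγ' h => (hint γ hγ γ' hγ' h).symm)
    refine ⟨_, _, hlt _ h₁ _ h₁' hne₁, hlt _ h₂ _ h₂' hne₂, hs₁, hs₂,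
      ⟨γ₁, h₁, γ₁', h₁', hne₁, rfl⟩, ⟨γ₂, h₂, γ₂', h₂', hne₂, rfl⟩, fun γ hγ γ' hγ' h => ?_⟩
    rcases hint γ hγ γ' hγ' h with h | h
    · exact Or.inl (hcast _ _ (hle _ hγ _) (hle _ h₁ _) (h.trans hs₁.symm))
    · exact Or.inr (hcast _ _ (hle _ hγ _) (hle _ h₂ _) (h.trans hs₂.symm))
  have hdk : ((d - k : ℕ) : ℤ) = d - k := by omega
  have hdkQ : ((d - k : ℕ) : ℚ) = d - k := by exact_mod_cast congrArg (Int.cast (R := ℚ)) hdk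
  refine ⟨lam₁, lam₂, ?_, ?_, hdes, isDesign_two_image hinj' hd hsub' hk' hpair₂, ?_, ?_, ?_⟩
  · have h0 : 2 * ((d - k : ℕ) : ℚ) ≠ 0 := by
      have : d - k ≠ 0 := by omega
      exact mul_ne_zero two_ne_zero (by exact_mod_cast this)
    rw [eq_div_iff h0, hdkQ]
    have := congrArg (Int.cast (R := ℚ)) hlam₁
    push_cast at this
    linear_combination this
  · have h0 : 2 * (k : ℚ) ≠ 0 := by
      have : k ≠ 0 := by omega
      exact mul_ne_zero two_ne_zero (by exact_mod_cast this)
    rw [eq_div_iff h0, hdkQ]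
    rw [hdk] at hlam₂
    have := congrArg (Int.cast (R := ℚ)) hlam₂
    push_cast at this
    linear_combination this
  · intro hn
    obtain ⟨s₁, s₂, hk₁, hk₂, hs₁, hs₂, ⟨γ₁, h₁, γ₁', h₁', hne₁, hi₁⟩,
      ⟨γ₂, h₂, γ₂', h₂', hne₂, hi₂⟩, hall⟩ := hquasi hn
    have hex₁ : ∃ S ∈ C.image A, ∃ S' ∈ C.image A, S ≠ S' ∧ (S ∩ S').card = s₁ :=
      ⟨_, Finset.mem_image_of_mem _ h₁, _, Finset.mem_image_of_mem _ h₁',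
        fun h => hne₁ (hinj h₁ h₁' h), hi₁⟩
    have hex₂ : ∃ S ∈ C.image A, ∃ S' ∈ C.image A, S ≠ S' ∧ (S ∩ S').card = s₂ :=
      ⟨_, Finset.mem_image_of_mem _ h₂, _, Finset.mem_image_of_mem _ h₂',
        fun h => hne₂ (hinj h₂ h₂' h), hi₂⟩
    refine ⟨s₁, s₂, isLeast_of_natCast_eq hp (by omega) hs₁,
      isLeast_of_natCast_eq hp (by omega) hs₂, hdes, min_le_max, ?_, ?_, ?_⟩
    · intro S hS S' hS' hne
      obtain ⟨γ, hγ, rfl⟩ := Finset.mem_image.1 hS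
      obtain ⟨γ', hγ', rfl⟩ := Finset.mem_image.1 hS'
      have := hall γ hγ γ' hγ' (fun h => hne (congrArg A h))
      omega
    · rcases min_choice s₁ s₂ with h | h <;> rw [h]
      exacts [hex₁, hex₂]
    · rcases max_choice s₁ s₂ with h | h <;> rw [h]
      exacts [hex₁, hex₂]
  · intro hn
    -- For `d ≥ 4` the hypothesis gives `n > 2d`, so both intersection numbers occur; being distinct
    -- and below `k`, they force `k ≥ 2`. For `d < 4` there are no 4-subsets to count.
    by_cases hd4 : 4 ≤ d
    · obtain ⟨s₁, s₂, hk₁, hk₂, hs₁, hs₂, -, -, hall⟩ := hquasi (by nlinarith)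
      have hss : s₁ ≠ s₂ := fun h => he (by rw [← hs₁, ← hs₂, h])
      refine exists_isDesign_four hinj hd hsub hk ?_ (by omega) hk₁ hk₂ hall hpair₁
      rw [Nat.choose_two_right]
      obtain ⟨d', rfl⟩ : ∃ d', d = d' + 1 := ⟨d - 1, by omega⟩
      have h3 : 2 * C.card = (d' + 1) * d' := by nlinarith
      rw [Nat.add_sub_cancel]
      omega
    · refine ⟨0, isDesign_image hinj hd hsub hk fun T hT ht => ?_⟩
      have := Finset.card_le_card hT
      omega
  · intro hn
    have hCd : C.card = d := by omega
    obtain ⟨hdl, hr⟩ := card_filter_mem_eq_of_square hsub hk hd hCd (by omega) (by omega)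
      (by omega) hl
    have h0 : 2 * ((d : ℤ) - k) ≠ 0 := by omega
    -- Eliminates `l` between the pair count and the replication identity.
    have hkl : (lam₁ : ℤ) * (d - 1) = k * (k - 1) := by
      apply mul_left_cancel₀ h0
      linear_combination ((d : ℤ) - 1) * hlam₁ + ((k : ℤ) - 1) * hdl
    have hall : ∀ γ ∈ C, ∀ γ' ∈ C, γ ≠ γ' → (A γ ∩ A γ').card = lam₁ :=
      fun γ hγ γ' hγ' h => card_inter_eq_of_card_eq hsub hk hCd hr hpair₁ hkl hγ' hγ h
    obtain ⟨γ, hγ, γ', hγ', h⟩ := Finset.one_lt_card.1 (show 1 < C.card by omega)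
    have hlam_le : lam₁ ≤ d := hall γ hγ γ' hγ' h ▸ hle γ hγ γ'
    refine ⟨lam₁, ?_, hdes, by rw [Finset.card_image_of_injOn hinj, hCd], ?_⟩
    · have := hint γ hγ γ' hγ' h
      rw [hall γ hγ γ' hγ' h] at this
      exact this.imp (isLeast_of_natCast_eq hp hlam_le) (isLeast_of_natCast_eq hp hlam_le)
    · intro S hS S' hS' hne
      obtain ⟨γ, hγ, rfl⟩ := Finset.mem_image.1 hS
      obtain ⟨γ', hγ', rfl⟩ := Finset.mem_image.1 hS'
      exact hall γ hγ γ' hγ' (fun h => hne (congrArg A h))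

end Assembly

/-! ### The main theorem -/

theorem mainTheorem3 {F V : Type*} [Field F] [Finite F] [AddCommGroup V] [Module F V]
    [FiniteDimensional F V] (B : LinearMap.BilinForm F V) (hsymm : B.IsSymm)
    (hnondeg : B.Nondegenerate)
    (n d l m : ℕ) (hd : Module.finrank F V = d) (hd2 : 2 ≤ d) (hchar : d < ringChar F)
    (a b β : F) (hβ : β ^ 2 = b) (hb : b ≠ 0) (hab : a ^ 2 ≠ b) (ha : a ≠ 0)
    (Φ : Fin n → V) (hΦ : IsEquiangular B a b Φ)
    (hreg : IsRegularTwoGraph n l m (coherentTriples B β Φ))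
    (Γ : Finset (Fin n)) (hΓ : Maximal (IsIncoherent B β Φ) Γ) (hcard : Γ.card = d)
    (hind : LinearIndependent F (fun i : Γ => Φ i)) :
    ∃ g₁ g₂ : ℕ, g₁ + g₂ = d ∧ g₁ ≤ g₂ ∧
      (∀ γ, γ ∉ Γ → (∃ A₁ A₂, IsSplitting B β Φ Γ γ A₁ A₂) ∧
        ∀ A₁ A₂, IsSplitting B β Φ Γ γ A₁ A₂ → A₁.card = g₁ ∧ A₂.card = g₂) ∧
      (g₁ ≠ g₂ →
        ∃ lam₁ lam₂ : ℕ,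
          (lam₁ : ℚ) = (l : ℚ) * ((g₁ : ℚ) - 1) / (2 * (g₂ : ℚ)) ∧
          (lam₂ : ℚ) = (l : ℚ) * ((g₂ : ℚ) - 1) / (2 * (g₁ : ℚ)) ∧
          IsDesign 2 d g₁ lam₁ Γ (blocks₁ B β Φ Γ) ∧
          IsDesign 2 d g₂ lam₂ Γ (blocks₂ B β Φ Γ) ∧
          (2 * d < n → ∃ s₁ s₂ : ℕ,
            IsLeast {s : ℕ | (s : F) = (g₁ : F) - (a * β⁻¹ - 1) ^ 2 / 4} s₁ ∧
            IsLeast {s : ℕ | (s : F) = (g₁ : F) - ((a * β⁻¹) ^ 2 - 1) / 4} s₂ ∧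
            IsQuasiSymmetricDesign d g₁ lam₁ (min s₁ s₂) (max s₁ s₂) Γ (blocks₁ B β Φ Γ)) ∧
          (2 * n = d * (d + 1) → ∃ lam : ℕ, IsDesign 4 d g₁ lam Γ (blocks₁ B β Φ Γ)) ∧
          (n = 2 * d → ∃ s : ℕ,
            (IsLeast {s : ℕ | (s : F) = (g₁ : F) - (a * β⁻¹ - 1) ^ 2 / 4} s ∨
              IsLeast {s : ℕ | (s : F) = (g₁ : F) - ((a * β⁻¹) ^ 2 - 1) / 4} s) ∧
            IsSymmetricDesign d g₁ lam₁ s Γ (blocks₁ B β Φ Γ))) ∧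
      (g₁ = g₂ → ∃ lam : ℕ, (lam : ℤ) = (n : ℤ) - d - l ∧
        IsDesign 2 d (d / 2) lam Γ (blocks₁ B β Φ Γ ∪ blocks₂ B β Φ Γ)) := by
  subst hβ
  have hβ0 : β ≠ 0 := fun h => hb (by rw [h]; ring)
  have h2 : (2 : F) ≠ 0 := by
    intro h
    have := natCast_eq_of_le (F := F) hchar (x := 2) (y := 0) hd2 (by omega) (by exact_mod_cast h)
    omega
  have h4 : (4 : F) ≠ 0 := by
    have := mul_ne_zero h2 h2
    norm_num at this
    exact this
  have hne1 : a - β ≠ 0 := fun h => hab (by linear_combination (a + β) * h)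
  have hne2 : a + β ≠ 0 := fun h => hab (by linear_combination (a - β) * h)
  have hΓne : Γ.Nonempty := Finset.card_pos.1 (by omega)
  have hspan : ⊤ ≤ Submodule.span F (Set.range (fun i : Γ => Φ i)) :=
    (hind.span_eq_top_of_card_eq_finrank' (by rw [Fintype.card_coe, hcard, hd])).ge
  obtain ⟨D, hD, A, hAsub, hAcard, hcoh, hform⟩ :=
    exists_parts hsymm hnondeg h2 hβ0 hΦ hΓ.prop hΓne hind hspan
  rw [hcard] at hform hAcard
  have hinc := (isIncoherent_iff_not_subset hsymm h2 hβ0 hΦ).1 hΓ.prop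
  have hl := fun α (hα : α ∈ Γ) δ (hδ : δ ∈ Γ) (h : α ≠ δ) =>
    card_separating hinc hreg hcoh hα hδ h
  have hcompl : Γᶜ.card + d = n := by
    rw [Finset.card_compl, Fintype.card_fin, hcard]
    have := Finset.card_le_univ Γ
    rw [Fintype.card_fin, hcard] at this
    omega
  have hnonempty : ∀ γ, γ ∉ Γ → (A γ).Nonempty := fun γ hγ =>
    nonempty_of_maximal hsymm h2 hβ0 hΦ hΓ hγ (hcoh γ hγ)
  have hcardc : ∀ γ, (Γ \ A γ).card = d - (A γ).card := fun γ => by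
    rw [Finset.card_sdiff_of_subset (hAsub γ), hcard]
  have hsplit : ∀ γ, γ ∉ Γ → ∀ A₁ A₂, IsSplitting B β Φ Γ γ A₁ A₂ ↔
      ((A₁ = A γ ∧ A₂ = Γ \ A γ) ∨ (A₁ = Γ \ A γ ∧ A₂ = A γ)) ∧ A₁.card ≤ A₂.card := by
    intro γ hγ A₁ A₂
    refine isSplitting_iff (hAsub γ) (hnonempty γ hγ) (Finset.card_pos.1 ?_) (hcoh γ hγ)
    have := hAcard γ
    rw [hcardc]; omega
  by_cases hC : ∃ γ₀, γ₀ ∉ Γ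
  swap
  · push Not at hC
    have hCe : Γᶜ = ∅ := by
      rw [Finset.compl_eq_empty_iff]
      exact Finset.eq_univ_of_forall hC
    have hb₁ : blocks₁ B β Φ Γ = ∅ := by
      simp [blocks₁, hC]
    have hb₂ : blocks₂ B β Φ Γ = ∅ := by
      simp [blocks₂, hC]
    have hl0 : l = 0 := by
      obtain ⟨α, hα, δ, hδ, h⟩ := Finset.one_lt_card.1 (show 1 < Γ.card by omega)
      rw [← hl α hα δ hδ h, hCe]; simp
    have hdes : ∀ g, IsDesign 2 d g 0 Γ (∅ : Finset (Finset (Fin n))) := fun g =>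
      ⟨hcard, by simp, by simp, by simp⟩
    rw [hCe, Finset.card_empty] at hcompl
    rw [hb₁, hb₂]
    -- With `Φ = Γ` there is no part to measure, and `(0, d)` is an admissible choice. Here `n = d ≥
    -- 2` excludes all three conditions on `n`, and the quotient with denominator `2 * 0` has the
    -- value `0`, as needed.
    refine ⟨0, d, by omega, by omega, fun γ hγ => absurd (hC γ) hγ, fun _ => ?_, fun h => ?_⟩
    · refine ⟨0, 0, by simp [hl0], by simp [hl0], hdes _, hdes _, fun h => ?_, fun h => ?_,
        fun h => ?_⟩
      · omega
      · nlinarith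
      · omega
    · omega
  obtain ⟨γ₀, hγ₀⟩ := hC
  obtain ⟨k, hkdef⟩ : ∃ k, k = (A γ₀).card := ⟨_, rfl⟩
  have hnorm : ∀ γ, γ ∉ Γ → (a - β) * D * a = β ^ 2 *
      (D * ((d : F) - 2 * (A γ).card - 2 * (A γ).card + 4 * (A γ).card)
        - β * (2 * (A γ).card - d) * (2 * (A γ).card - d)) := by
    intro γ hγ
    obtain ⟨τ, -, hτ, h⟩ := hform γ hγ γ hγ
    rwa [hτ rfl, one_mul, hΦ.norm_eq, Finset.inter_self] at h
  have hk : ∀ γ, γ ∉ Γ → (A γ).card = k := fun γ hγ => by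
    rw [hkdef]
    exact card_eq_of_norm_eq hchar h2 hβ0 (hAcard γ) (hAcard γ₀) (hnorm γ hγ) (hnorm γ₀ hγ₀)
  have hk1 : 1 ≤ k := hkdef ▸ Finset.card_pos.2 (hnonempty γ₀ hγ₀)
  have hkd : 2 * k ≤ d := hkdef ▸ hAcard γ₀
  have hmul : ∀ γ, γ ∉ Γ → ∀ γ', γ' ∉ Γ → γ ≠ γ' → ∃ ε : F, (ε = 1 ∨ ε = -1) ∧
      (a - β) * (a - ε * β) = 4 * β ^ 2 * (k - (A γ ∩ A γ').card) := by
    intro γ hγ γ' hγ' h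
    obtain ⟨τ, hτ, -, h3⟩ := hform γ hγ γ' hγ'
    have h5 := hnorm γ hγ
    rw [hk γ hγ] at h5
    rw [hk γ hγ, hk γ' hγ'] at h3
    obtain ⟨ε, hε, h6⟩ : ∃ ε : F, (ε = 1 ∨ ε = -1) ∧ τ * B (Φ γ) (Φ γ') = ε * β := by
      rcases bilin_eq_or_neg hsymm hΦ h with h | h <;> rcases hτ with h' | h' <;> rw [h, h']
      exacts [⟨1, Or.inl rfl, rfl⟩, ⟨-1, Or.inr rfl, rfl⟩, ⟨-1, Or.inr rfl, by ring⟩,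
        ⟨1, Or.inl rfl, by ring⟩]
    rw [h6] at h3
    exact ⟨ε, hε, sub_mul_sub_eq hD h5 h3⟩
  have hεne : ∀ ε : F, (ε = 1 ∨ ε = -1) → a - ε * β ≠ 0 ∧ a + ε * β ≠ 0 := by
    rintro ε (rfl | rfl)
    · rw [one_mul]; exact ⟨hne1, hne2⟩
    · rw [neg_one_mul, sub_neg_eq_add, ← sub_eq_add_neg]; exact ⟨hne2, hne1⟩
  -- Equal parts would have intersection size `k`, so `(a - β)(a - εβ) = 0`, against `a² ≠ b`.
  have hinj : Set.InjOn A (Γᶜ : Finset (Fin n)) := by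
    intro γ hγ γ' hγ' h
    have hγ := Finset.mem_compl.1 (Finset.mem_coe.1 hγ)
    have hγ' := Finset.mem_compl.1 (Finset.mem_coe.1 hγ')
    by_contra hne
    obtain ⟨ε, hε, h3⟩ := hmul γ hγ γ' hγ' hne
    rw [← h, Finset.inter_self, hk γ hγ, sub_self, mul_zero] at h3
    exact mul_ne_zero hne1 (hεne ε hε).1 h3
  have hsubC : ∀ γ ∈ Γᶜ, A γ ⊆ Γ := fun γ _ => hAsub γ
  have hkC : ∀ γ ∈ Γᶜ, (A γ).card = k := fun γ hγ => hk γ (Finset.mem_compl.1 hγ)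
  refine ⟨k, d - k, by omega, by omega, fun γ hγ => ⟨⟨A γ, Γ \ A γ, ?_⟩, ?_⟩, ?_, ?_⟩
  · rw [hsplit γ hγ, hcardc, hk γ hγ]
    exact ⟨Or.inl ⟨rfl, rfl⟩, by omega⟩
  · intro A₁ A₂ h
    obtain ⟨⟨rfl, rfl⟩ | ⟨rfl, rfl⟩, h5⟩ := (hsplit γ hγ _ _).1 h <;>
      rw [hcardc, hk γ hγ] at * <;> omega
  · intro hne
    have hb₁ : blocks₁ B β Φ Γ = Γᶜ.image A := by
      ext S
      simp only [blocks₁, Finset.mem_filter, Finset.mem_univ, true_and, Finset.mem_image,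
        Finset.mem_compl]
      refine exists_congr fun γ => and_congr_right fun hγ => ?_
      constructor
      · rintro ⟨A₂, h⟩
        obtain ⟨⟨rfl, rfl⟩ | ⟨rfl, rfl⟩, h5⟩ := (hsplit γ hγ _ _).1 h
        · rfl
        · rw [hcardc, hk γ hγ] at h5; omega
      · rintro rfl
        refine ⟨Γ \ A γ, (hsplit γ hγ _ _).2 ⟨Or.inl ⟨rfl, rfl⟩, ?_⟩⟩
        rw [hcardc, hk γ hγ]; omega
    have hb₂ : blocks₂ B β Φ Γ = Γᶜ.image (fun γ => Γ \ A γ) := by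
      ext S
      simp only [blocks₂, Finset.mem_filter, Finset.mem_univ, true_and, Finset.mem_image,
        Finset.mem_compl]
      refine exists_congr fun γ => and_congr_right fun hγ => ?_
      constructor
      · rintro ⟨A₁, h⟩
        obtain ⟨⟨rfl, rfl⟩ | ⟨rfl, rfl⟩, h5⟩ := (hsplit γ hγ _ _).1 h
        · rfl
        · rw [hcardc, hk γ hγ] at h5; omega
      · rintro rfl
        refine ⟨A γ, (hsplit γ hγ _ _).2 ⟨Or.inl ⟨rfl, rfl⟩, ?_⟩⟩
        rw [hcardc, hk γ hγ]; omega
    rw [hb₁, hb₂]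
    refine designs_of_ne hchar hcard hcompl hk1 (by omega) hsubC hkC hl hinj ?_ ?_
    -- The two residues differ by `(ρ - 1)/2`, which is nonzero because `a ≠ β`.
    · intro h
      field_simp at h
      exact mul_ne_zero h2 (mul_ne_zero hβ0 hne1) (by linear_combination h)
    · intro γ hγ γ' hγ' h
      obtain ⟨ε, hε, h3⟩ := hmul γ (Finset.mem_compl.1 hγ) γ' (Finset.mem_compl.1 hγ') h
      exact eq_sub_of_sub_mul_sub hβ0 h4 hε h3
  · intro heq
    have hd2k : d = 2 * k := by omega
    -- Complementary parts meet in nothing, so `(a - β)(a - εβ) = 4β²k`, while the norm equation for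
    -- `d = 2k` reads `(a - β)a = 2β²k`. Together they give `(a - β)(a + εβ) = 0`.
    have hinj' : ∀ γ ∈ Γᶜ, ∀ γ' ∈ Γᶜ, A γ ≠ Γ \ A γ' := by
      intro γ hγ γ' hγ' h
      have hγ := Finset.mem_compl.1 hγ
      have hγ' := Finset.mem_compl.1 hγ'
      have hempty : A γ ∩ A γ' = ∅ := by
        rw [h, ← Finset.disjoint_iff_inter_eq_empty]; exact Finset.sdiff_disjoint
      by_cases hne : γ = γ'
      · subst hne
        rw [Finset.inter_self] at hempty
        exact (hnonempty γ hγ).ne_empty hempty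
      · obtain ⟨ε, hε, h3⟩ := hmul γ hγ γ' hγ' hne
        have h5 := hnorm γ hγ
        rw [hempty, Finset.card_empty, Nat.cast_zero, sub_zero] at h3
        rw [hk γ hγ, show (d : F) = 2 * k by rw [hd2k]; push_cast; ring] at h5
        have h6 : (a - β) * a = β ^ 2 * (2 * k) := by
          apply mul_left_cancel₀ hD
          linear_combination h5
        refine mul_ne_zero hne1 (hεne ε hε).2 ?_
        linear_combination 2 * h6 - h3
    have hun : blocks₁ B β Φ Γ ∪ blocks₂ B β Φ Γ
        = Γᶜ.image A ∪ Γᶜ.image (fun γ => Γ \ A γ) := by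
      -- For equal sizes both labellings are allowed, so each of the two block sets already contains
      -- every part.
      have hboth : ∀ γ, γ ∉ Γ → IsSplitting B β Φ Γ γ (A γ) (Γ \ A γ) ∧
          IsSplitting B β Φ Γ γ (Γ \ A γ) (A γ) := by
        intro γ hγ
        rw [hsplit γ hγ, hsplit γ hγ, hcardc, hk γ hγ]
        exact ⟨⟨Or.inl ⟨rfl, rfl⟩, by omega⟩, ⟨Or.inr ⟨rfl, rfl⟩, by omega⟩⟩
      ext S
      simp only [blocks₁, blocks₂, Finset.mem_filter, Finset.mem_univ, true_and, Finset.mem_image,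
        Finset.mem_compl, Finset.mem_union]
      constructor
      · rintro (⟨γ, hγ, A₂, h⟩ | ⟨γ, hγ, A₁, h⟩) <;>
          obtain ⟨⟨rfl, rfl⟩ | ⟨rfl, rfl⟩, -⟩ := (hsplit γ hγ _ _).1 h
        exacts [Or.inl ⟨γ, hγ, rfl⟩, Or.inr ⟨γ, hγ, rfl⟩, Or.inr ⟨γ, hγ, rfl⟩,
          Or.inl ⟨γ, hγ, rfl⟩]
      · rintro (⟨γ, hγ, rfl⟩ | ⟨γ, hγ, rfl⟩)
        · exact Or.inl ⟨γ, hγ, _, (hboth γ hγ).1⟩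
        · exact Or.inl ⟨γ, hγ, _, (hboth γ hγ).2⟩
    have hlle : l ≤ Γᶜ.card := by
      obtain ⟨α, hα, δ, hδ, h⟩ := Finset.one_lt_card.1 (show 1 < Γ.card by omega)
      rw [← hl α hα δ hδ h]
      exact Finset.card_filter_le _ _
    refine ⟨Γᶜ.card - l, by omega, ?_⟩
    rw [hun, show d / 2 = k by omega]
    have := isDesign_union_compl hsubC hkC (hcard.trans hd2k) hinj hinj'
      (lam := Γᶜ.card - l) (by omega) hl
    rwa [← hd2k] at this
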